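/- Let $d\ge2$, $-d<\gamma\le0$, with $\gamma<0$ if $d=2$, and let $b_0>0$, $0\le\nu\le1$. Put $$\lambda_1=\frac34+\frac{2\nu+d-\gamma-2}{d-\gamma-2},\qquad \mathcal M(v)=(2\pi)^{-d/2}e^{-|v|^2/2}.$$ There is a constant $C>0$, depending only on $d,\gamma,b_0,\nu$, with the following property. Let $b\ge0$ be a measurable even function on $[-1,1]$ with $\int_{\mathbb S^{d-1}}b(e\cdot\sigma)\,d\sigma=1$ for every unit vector $e$, and with $b(x)\ge b_0(1-x^2)^{\nu/2}$ for $x\in(-1,1)$. Consider the linear Boltzmann equation $\partial_tf=L_\gamma f$, $f(0)=f_0$, where $$L_\gamma f(v)=\int_{\mathbb R^d\times\mathbb S^{d-1}}|v-v_*|^\gamma\, b\Big(\tfrac{v-v_*}{|v-v_*|}\cdot\sigma\Big)\big(f(v')\mathcal M(v_*')-f(v)\mathcal M(v_*)\big)\,dv_*\,d\sigma,$$ $$v'=\tfrac{v+v_*}2+\tfrac{|v-v_*|}2\sigma,\qquad v_*'=\tfrac{v+v_*}2-\tfrac{|v-v_*|}2\sigma .$$ Let $f_0\in L^1(\mathbb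 R^d)$ be nonnegative with $\int f_0\,dv=1$ and $\int|v|^2f_0\,dv<\infty$, and let $f\in C([0,\infty);L^1(\mathbb R^d))$ be a nonnegative mild solution, i.e. $f(0)=f_0$ and $f(t)=f_0+L_\gamma\big(\int_0^tf(\tau)\,d\tau\big)$ a.e. for every $t\ge0$. Then for every $t>0$, for almost every $v\in\mathbb R^d$, and for all $s>0$ and $0<t_0<t$, $$f(t,v)\ \ge\ C\big(1-e^{-\|\Sigma_\gamma\|_\infty t_0}\big)\exp\Big(-\lambda_1\Big(|v|^2+\sup_{0\le\tau\le t}(2m_s(\tau))^{2/s}\Big)\Big).$$ Here $$\Sigma_\gamma(v)=\int_{\mathbb R^d\times\mathbb S^{d-1}}|v-v_*|^\gamma\, b\Big(\tfrac{v-v_*}{|v-v_*|}\cdot\sigma\Big)\mathcal M(v_*)\,dv_*\,d\sigma,\qquad \|\Sigma_\gamma\|_\infty=\sup_v\Sigma_\gamma(v),$$ $m_s(\tau)=\int|v|^sf(\tau,v)\,dv\in[0,\infty]$, and $\exp(-\infty)=0$. -/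

import Mathlib

open MeasureTheory Set
open scoped ENNReal

noncomputable section

namespace LinearBoltzmann

/-- The velocity space `ℝ^d` with its Euclidean structure. -/
abbrev Vel (d : ℕ) := EuclideanSpace ℝ (Fin d)

/-- The unit sphere of `ℝ^d`. -/
abbrev USphere (d : ℕ) := Metric.sphere (0 : Vel d) 1

/-- The surface measure `dσ` on the unit sphere. -/
def surface (d : ℕ) : Measure (USphere d) := (volume : Measure (Vel d)).toSphere

/-- The space `L¹(ℝ^d)`. -/
abbrev LOne (d : ℕ) := Lp ℝ 1 (volume : Measure (Vel d))

/-- The normalised Maxwellian. -/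
def maxwellian (d : ℕ) (v : Vel d) : ℝ :=
  1 / (2 * Real.pi) ^ ((d : ℝ) / 2) * Real.exp (-(‖v‖ ^ 2) / 2)

/-- The pre-collisional velocity `v'`. -/
def vPrime {d : ℕ} (v vs : Vel d) (σ : USphere d) : Vel d :=
  (1 / 2 : ℝ) • (v + vs) + (‖v - vs‖ / 2) • (σ : Vel d)

/-- The pre-collisional velocity `v'_*`. -/
def vsPrime {d : ℕ} (v vs : Vel d) (σ : USphere d) : Vel d :=
  (1 / 2 : ℝ) • (v + vs) - (‖v - vs‖ / 2) • (σ : Vel d)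

/-- The cosine of the deviation angle, `cos θ = (v - v_*) / |v - v_*| · σ`. -/
def cosDev {d : ℕ} (v vs : Vel d) (σ : USphere d) : ℝ :=
  inner ℝ (‖v - vs‖⁻¹ • (v - vs)) (σ : Vel d)

/-- The interaction kernel `|v - v_*|^γ b(cos θ)`. -/
def kernel {d : ℕ} (γ : ℝ) (b : ℝ → ℝ) (v vs : Vel d) (σ : USphere d) : ℝ :=
  ‖v - vs‖ ^ γ * b (cosDev v vs σ)

/-- The bilinear Boltzmann collision operator `Q_γ(f, g)`. -/
def collision {d : ℕ} (γ : ℝ) (b : ℝ → ℝ) (f g : Vel d → ℝ) (v : Vel d) : ℝ :=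
  ∫ p : Vel d × USphere d,
    kernel γ b v p.1 p.2 * (f (vPrime v p.1 p.2) * g (vsPrime v p.1 p.2) - f v * g p.1)
    ∂(volume.prod (surface d))

/-- The linear Boltzmann operator `L_γ f = Q_γ(f, M)`. -/
def linOp {d : ℕ} (γ : ℝ) (b : ℝ → ℝ) (f : Vel d → ℝ) (v : Vel d) : ℝ :=
  collision γ b f (maxwellian d) v

/-- The collision frequency `Σ_γ(v)`. -/
def collisionFreq {d : ℕ} (γ : ℝ) (b : ℝ → ℝ) (v : Vel d) : ℝ :=
  ∫ p : Vel d × USphere d, kernel γ b v p.1 p.2 * maxwellian d p.1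
    ∂(volume.prod (surface d))

/-- The supremum norm `‖Σ_γ‖_∞` of the collision frequency. -/
def collisionFreqNorm (d : ℕ) (γ : ℝ) (b : ℝ → ℝ) : ℝ :=
  ⨆ v : Vel d, |collisionFreq γ b v|

/-- An angular kernel in dimension `d`: nonnegative and even on `[-1, 1]`, with `‖b‖₁ = 1`
(Grad's cut-off assumption with the usual normalisation). In particular `σ ↦ b(e · σ)` is
integrable, the integral of a non-integrable function being `0` by convention. -/
structure IsAngularKernel (d : ℕ) (b : ℝ → ℝ) : Prop where
  measurable : Measurable b
  nonneg : ∀ x ∈ Icc (-1 : ℝ) 1, 0 ≤ b x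
  even : ∀ x ∈ Icc (-1 : ℝ) 1, b (-x) = b x
  norm_eq_one : ∀ e : Vel d, ‖e‖ = 1 →
    ∫ σ : USphere d, b (inner ℝ e (σ : Vel d)) ∂(surface d) = 1

/-- `f : [0, ∞) → L¹(ℝ^d)` is a mild solution of `∂ₜ f = L_γ f`, `f(0) = f₀`: it is continuous
in `L¹` and `f(t) = f₀ + L_γ (∫₀ᵗ f(τ) dτ)` for all `t ≥ 0`. Values at negative times are
irrelevant. -/
structure IsMildSolution {d : ℕ} (γ : ℝ) (b : ℝ → ℝ) (f₀ : LOne d) (f : ℝ → LOne d) : Prop where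
  initial : f 0 = f₀
  continuousOn : ContinuousOn f (Ici 0)
  equation : ∀ t : ℝ, 0 ≤ t → ∀ᵐ v : Vel d,
    f t v = f₀ v + linOp γ b (⇑(∫ τ in (0 : ℝ)..t, f τ)) v

/-- The moment `m_s(g) = ∫ |v|^s g(v) dv` of a nonnegative function, with values in `[0, ∞]`. -/
def moment {d : ℕ} (s : ℝ) (g : Vel d → ℝ) : ℝ≥0∞ :=
  ∫⁻ v : Vel d, ENNReal.ofReal (‖v‖ ^ s * g v)

/-- `exp(-a)` for `a ∈ [0, ∞]`, with `exp(-∞) = 0`. -/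
def expNeg (a : ℝ≥0∞) : ℝ := if a = ∞ then 0 else Real.exp (-a.toReal)

/-- The constant `λ₁ = 3/4 + (2ν + d - γ - 2) / (d - γ - 2)`. -/
def lambdaOne (d : ℕ) (γ ν : ℝ) : ℝ :=
  3 / 4 + (2 * ν + (d : ℝ) - γ - 2) / ((d : ℝ) - γ - 2)

end LinearBoltzmann

end

open MeasureTheory Set
open scoped ENNReal

noncomputable section

namespace LinearBoltzmann

variable {d : ℕ}

/-! A single collision with the Maxwellian background sends mass everywhere: the density of jumping
from `v` to `x` is at least `κ * weight v * weight x`, where `weight x = exp(-7|x|²/4)`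
(`exists_transition_ge`). It is enough to keep the collisions with `v' - v` in a cone around `σ`.
There the deviation angle stays away from `0` and `π`, all lengths are comparable to `|v' - v|`, and
`v_* - v ↦ v' - v` is a contraction, so no Jacobian is needed.

The collision involution preserves `dv dv_* dσ`, which puts the operator in weak form
(`setIntegral_linOp`). Testing against a set `B` makes `y(t) = ∫_B f(t)` satisfy, in integrated
form, `y' ≥ κ (∫_B weight) (∫ weight f) - ‖Σ‖ y`. Duhamel's inequality (`ge_of_increment`) bounds
`y` below by a multiple of `∫_B weight`. As `B` is arbitrary, this is a bound for almost every `v`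
(`IsMildSolution.ae_ge`).

The remaining factor is the minimum over `[0, t]` of `∫ weight f(τ)`. Conservation of mass and
Chebyshev's inequality bound it by a moment at the minimising time (`integral_weight_mul_ge`).
Finally `7/4 ≤ λ₁`. -/

instance : IsFiniteMeasure (surface d) := by unfold surface; infer_instance

/-! ### Polar coordinates and the collision involution -/

lemma ne_zero_of_sphere (e₀ : USphere d) : d ≠ 0 := by
  rintro rfl
  have h := e₀.2
  rw [Subsingleton.elim (e₀ : Vel 0) 0] at h
  simp at h

/-- Integration in polar coordinates. -/
lemma lintegral_polar (hd : d ≠ 0) {F : Vel d → ℝ≥0∞} (hF : Measurable F) :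
    ∫⁻ u, F u = ∫⁻ e, ∫⁻ r, F (r.1 • (e : Vel d)) ∂(Measure.volumeIoiPow (d - 1)) ∂(surface d) := by
  have : Nonempty (Fin d) := ⟨⟨0, Nat.pos_of_ne_zero hd⟩⟩
  have h := (volume : Measure (Vel d)).measurePreserving_homeomorphUnitSphereProd
  simp only [finrank_euclideanSpace, Fintype.card_fin] at h
  have hm : Measurable fun p : USphere d × Ioi (0 : ℝ) => F (p.2.1 • (p.1 : Vel d)) := by
    fun_prop
  calc ∫⁻ u, F u = ∫⁻ u in {(0 : Vel d)}ᶜ, F u := by rw [restrict_compl_singleton]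
    _ = ∫⁻ u : ({(0 : Vel d)}ᶜ : Set (Vel d)), F u
          ∂(Measure.comap Subtype.val volume) := by
      rw [lintegral_subtype_comap (measurableSet_singleton _).compl]
    _ = ∫⁻ p : USphere d × Ioi (0 : ℝ), F (p.2.1 • (p.1 : Vel d))
          ∂((surface d).prod (Measure.volumeIoiPow (d - 1))) := by
      rw [surface, ← h.lintegral_comp hm]
      refine lintegral_congr fun u => ?_
      have hu : ‖(u : Vel d)‖ ≠ 0 := norm_ne_zero_iff.2 u.2
      simp [smul_smul, hu]
    _ = _ := lintegral_prod _ hm.aemeasurable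

/-- The direction `u / |u|` of a vector, with the value `e₀` at `u = 0`. -/
def dir (e₀ : USphere d) (u : Vel d) : USphere d :=
  if h : u = 0 then e₀ else ⟨‖u‖⁻¹ • u, by simp [norm_smul, h]⟩

lemma measurable_dir (e₀ : USphere d) : Measurable (dir e₀) := by
  refine Measurable.subtype_mk (f := fun u => ((dir e₀ u : USphere d) : Vel d)) ?_
  have : (fun u : Vel d => ((dir e₀ u : USphere d) : Vel d)) =
      fun u => if u = 0 then (e₀ : Vel d) else ‖u‖⁻¹ • u := by
    ext1 u
    by_cases h : u = 0 <;> simp [dir, h]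
  rw [this]
  refine Measurable.ite (measurableSet_singleton _) measurable_const (by fun_prop)

lemma norm_smul_dir (e₀ : USphere d) (u : Vel d) : ‖u‖ • (dir e₀ u : Vel d) = u := by
  by_cases h : u = 0
  · simp [h]
  · simp [dir, h, smul_smul]

lemma dir_smul (e₀ : USphere d) {r : ℝ} (hr : 0 < r) (e : USphere d) :
    dir e₀ (r • (e : Vel d)) = e := by
  have he : ‖(e : Vel d)‖ = 1 := by simp
  have h : r • (e : Vel d) ≠ 0 := by
    rw [← norm_ne_zero_iff, norm_smul, he]; simp [hr.ne']
  ext1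
  simp [dir, h, norm_smul, smul_smul, abs_of_pos hr, hr.ne']

/-- Exchanging the direction of the relative velocity and the vector `σ` preserves the measure. -/
lemma lintegral_swap_dir (e₀ : USphere d) {H : Vel d × USphere d → ℝ≥0∞} (hH : Measurable H) :
    ∫⁻ u, ∫⁻ σ, H (‖u‖ • (σ : Vel d), dir e₀ u) ∂(surface d) =
      ∫⁻ u, ∫⁻ σ, H (u, σ) ∂(surface d) := by
  have hd := ne_zero_of_sphere e₀
  have hdir := measurable_dir e₀
  rw [lintegral_polar hd (Measurable.lintegral_prod_right'
      (f := fun p : Vel d × USphere d => H (‖p.1‖ • (p.2 : Vel d), dir e₀ p.1)) (by fun_prop)),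
    lintegral_polar hd (Measurable.lintegral_prod_right' (by fun_prop))]
  have h1 : ∀ e : USphere d, ∀ r : Ioi (0 : ℝ),
      ∫⁻ σ, H (‖r.1 • (e : Vel d)‖ • (σ : Vel d), dir e₀ (r.1 • (e : Vel d))) ∂(surface d) =
      ∫⁻ σ, H (r.1 • (σ : Vel d), e) ∂(surface d) := by
    intro e r
    rw [dir_smul e₀ r.2]
    simp [norm_smul, abs_of_pos (mem_Ioi.1 r.2)]
  -- In polar coordinates the exchange only permutes two sphere variables at a fixed radius, so
  -- Tonelli suffices.
  simp_rw [h1]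
  calc _ = ∫⁻ e, ∫⁻ σ, ∫⁻ r, H (r.1 • (σ : Vel d), e) ∂(Measure.volumeIoiPow (d - 1))
        ∂(surface d) ∂(surface d) := by
        refine lintegral_congr fun e => ?_
        rw [lintegral_lintegral_swap (by fun_prop)]
    _ = ∫⁻ σ, ∫⁻ e, ∫⁻ r, H (r.1 • (σ : Vel d), e) ∂(Measure.volumeIoiPow (d - 1))
        ∂(surface d) ∂(surface d) := by
        rw [lintegral_lintegral_swap]
        refine Measurable.aemeasurable ?_
        refine Measurable.lintegral_prod_right'
          (f := fun q : (USphere d × USphere d) × Ioi (0 : ℝ) =>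
            H (q.2.1 • (q.1.2 : Vel d), q.1.1)) (by fun_prop)
    _ = _ := by
        refine lintegral_congr fun e => ?_
        rw [lintegral_lintegral_swap (by fun_prop)]

/-- The measure `dv dv_* dσ` on the space of collisions. -/
abbrev collMeasure (d : ℕ) : Measure (Vel d × Vel d × USphere d) :=
  volume.prod (volume.prod (surface d))

/-- The collision involution `(v, v_*, σ) ↦ (v', v'_*, (v - v_*) / |v - v_*|)`. -/
def collMap (e₀ : USphere d) (p : Vel d × Vel d × USphere d) : Vel d × Vel d × USphere d :=
  (vPrime p.1 p.2.1 p.2.2, vsPrime p.1 p.2.1 p.2.2, dir e₀ (p.1 - p.2.1))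

lemma measurable_vPrime :
    Measurable fun p : Vel d × Vel d × USphere d => vPrime p.1 p.2.1 p.2.2 := by
  unfold vPrime; fun_prop

lemma measurable_vsPrime :
    Measurable fun p : Vel d × Vel d × USphere d => vsPrime p.1 p.2.1 p.2.2 := by
  unfold vsPrime; fun_prop

lemma measurable_collMap (e₀ : USphere d) : Measurable (collMap e₀) :=
  measurable_vPrime.prodMk
    (measurable_vsPrime.prodMk ((measurable_dir e₀).comp (by fun_prop)))

lemma lintegral_collMeasure {G : Vel d × Vel d × USphere d → ℝ≥0∞} (hG : Measurable G) :
    ∫⁻ p, G p ∂(collMeasure d) =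
      ∫⁻ u, ∫⁻ σ, (∫⁻ vs, G (vs + u, vs, σ)) ∂(surface d) := by
  calc _ = ∫⁻ q : Vel d × USphere d, (∫⁻ v, G (v, q)) ∂(volume.prod (surface d)) :=
        lintegral_prod_symm _ hG.aemeasurable
    _ = ∫⁻ q : Vel d × USphere d, (∫⁻ u, G (q.1 + u, q)) ∂(volume.prod (surface d)) := by
        refine lintegral_congr fun q => ?_
        exact (lintegral_add_left_eq_self (fun v => G (v, q)) q.1).symm
    _ = ∫⁻ u, ∫⁻ q : Vel d × USphere d, G (q.1 + u, q) ∂(volume.prod (surface d)) :=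
        lintegral_lintegral_swap (f := fun (q : Vel d × USphere d) u => G (q.1 + u, q))
          (by fun_prop)
    _ = _ := by
        refine lintegral_congr fun u => ?_
        rw [lintegral_prod_symm _ (by fun_prop)]

/-- With `u = v - v_*`, the map is a translation of `v_*` for fixed `(u, σ)`, followed by the
exchange of `u / |u|` with `σ`. Both preserve the measure. -/
lemma measurePreserving_collMap (e₀ : USphere d) :
    MeasurePreserving (collMap e₀) (collMeasure d) (collMeasure d) := by
  refine ⟨measurable_collMap e₀, Measure.ext_of_lintegral _ fun G hG => ?_⟩
  rw [lintegral_map hG (measurable_collMap e₀), lintegral_collMeasure hG,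
    lintegral_collMeasure (G := fun p => G (collMap e₀ p)) (hG.comp (measurable_collMap e₀))]
  have h : ∀ (u : Vel d) (σ : USphere d), ∫⁻ vs, G (collMap e₀ (vs + u, vs, σ)) =
      ∫⁻ vs, G (vs + ‖u‖ • (σ : Vel d), vs, dir e₀ u) := by
    intro u σ
    rw [← lintegral_add_right_eq_self (fun vs => G (vs + ‖u‖ • (σ : Vel d), vs, dir e₀ u))
      ((1 / 2 : ℝ) • u - (‖u‖ / 2) • (σ : Vel d))]
    refine lintegral_congr fun vs => ?_
    simp only [collMap, vPrime, vsPrime, add_sub_cancel_left]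
    congr 2
    · module
    · congr 1; module
  simp_rw [h]
  exact lintegral_swap_dir e₀
    (H := fun q : Vel d × USphere d => ∫⁻ vs, G (vs + q.1, vs, q.2))
    (Measurable.lintegral_prod_right'
      (f := fun z : (Vel d × USphere d) × Vel d => G (z.2 + z.1.1, z.2, z.1.2)) (by fun_prop))

lemma vPrime_sub_vsPrime (v vs : Vel d) (σ : USphere d) :
    vPrime v vs σ - vsPrime v vs σ = ‖v - vs‖ • (σ : Vel d) := by
  simp only [vPrime, vsPrime]; module

lemma norm_vPrime_sub_vsPrime (v vs : Vel d) (σ : USphere d) :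
    ‖vPrime v vs σ - vsPrime v vs σ‖ = ‖v - vs‖ := by
  simp [vPrime_sub_vsPrime, norm_smul]

lemma collMap_collMap (e₀ : USphere d) {v vs : Vel d} (h : v ≠ vs) (σ : USphere d) :
    collMap e₀ (collMap e₀ (v, vs, σ)) = (v, vs, σ) := by
  have h1 : 0 < ‖v - vs‖ := norm_pos_iff.2 (sub_ne_zero.2 h)
  have h2 := norm_smul_dir e₀ (v - vs)
  simp only [collMap, vPrime_sub_vsPrime, dir_smul e₀ h1 σ]
  simp only [Prod.mk.injEq, and_true]
  constructor
  · change (1 / 2 : ℝ) • (vPrime v vs σ + vsPrime v vs σ) +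
      (‖vPrime v vs σ - vsPrime v vs σ‖ / 2) • (dir e₀ (v - vs) : Vel d) = _
    rw [norm_vPrime_sub_vsPrime, div_eq_inv_mul ‖v - vs‖, mul_smul, h2]
    simp only [vPrime, vsPrime]; module
  · change (1 / 2 : ℝ) • (vPrime v vs σ + vsPrime v vs σ) -
      (‖vPrime v vs σ - vsPrime v vs σ‖ / 2) • (dir e₀ (v - vs) : Vel d) = _
    rw [norm_vPrime_sub_vsPrime, div_eq_inv_mul ‖v - vs‖, mul_smul, h2]
    simp only [vPrime, vsPrime]; module

lemma kernel_collMap (γ : ℝ) (b : ℝ → ℝ) (e₀ : USphere d) {v vs : Vel d} (h : v ≠ vs)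
    (σ : USphere d) :
    kernel γ b (vPrime v vs σ) (vsPrime v vs σ) (dir e₀ (v - vs)) = kernel γ b v vs σ := by
  have h1 : ‖v - vs‖ ≠ 0 := norm_ne_zero_iff.2 (sub_ne_zero.2 h)
  have h2 : v - vs ≠ 0 := sub_ne_zero.2 h
  unfold kernel cosDev
  rw [norm_vPrime_sub_vsPrime, vPrime_sub_vsPrime, smul_smul, inv_mul_cancel₀ h1, one_smul]
  congr 2
  rw [real_inner_comm]
  simp [dir, h2]

/-- Discards the set where `dir` takes its default value, off which `collMap` is an involution
leaving the kernel invariant. -/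
lemma ae_ne (hd : d ≠ 0) : ∀ᵐ p ∂(collMeasure d), p.1 ≠ p.2.1 := by
  have : Nonempty (Fin d) := ⟨⟨0, Nat.pos_of_ne_zero hd⟩⟩
  have hm : MeasurableSet {p : Vel d × Vel d × USphere d | p.1 ≠ p.2.1} :=
    (measurableSet_eq_fun (by fun_prop) (by fun_prop)).compl
  rw [Measure.ae_prod_iff_ae_ae hm]
  refine Filter.Eventually.of_forall fun v => ?_
  have hm' : MeasurableSet {p : Vel d × USphere d | v ≠ p.1} :=
    (measurableSet_eq_fun (by fun_prop) (by fun_prop)).compl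
  rw [Measure.ae_prod_iff_ae_ae hm']
  have := (volume : Measure (Vel d)).ae_ne v
  filter_upwards [this] with x hx
  exact Filter.Eventually.of_forall fun _ => hx.symm

/-! ### Geometry of collisions with displacement in a cone -/

lemma exists_unit_orthogonal (hd : 2 ≤ d) (n : Vel d) : ∃ m : Vel d, ‖m‖ = 1 ∧ inner ℝ n m = 0 := by
  have h : (Submodule.span ℝ {n})ᗮ ≠ ⊥ := by
    intro h
    have h1 := Submodule.finrank_add_finrank_orthogonal (Submodule.span ℝ {n})
    rw [h, finrank_bot, finrank_euclideanSpace, Fintype.card_fin] at h1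
    have h2 := finrank_span_le_card (R := ℝ) ({n} : Set (Vel d))
    simp at h2
    omega
  obtain ⟨x, hx, hx0⟩ := Submodule.exists_mem_ne_zero_of_ne_bot h
  have hn : ‖x‖ ≠ 0 := norm_ne_zero_iff.2 hx0
  refine ⟨‖x‖⁻¹ • x, by simp [norm_smul, hn], ?_⟩
  rw [inner_smul_right, Submodule.mem_orthogonal_singleton_iff_inner_right.1 hx, mul_zero]

/-- The vectors making with `σ` an angle whose cosine lies in `(9/10, 99/100)`. -/
def cone (σ : Vel d) : Set (Vel d) :=
  {w | 9 / 10 * ‖w‖ < inner ℝ w σ ∧ inner ℝ w σ < 99 / 100 * ‖w‖}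

lemma measurableSet_cone_prod :
    MeasurableSet {p : USphere d × Vel d | p.2 ∈ cone (p.1 : Vel d)} := by
  have : Measurable fun p : USphere d × Vel d => (inner ℝ p.2 (p.1 : Vel d) : ℝ) := by fun_prop
  exact (measurableSet_lt (by fun_prop) this).inter (measurableSet_lt this (by fun_prop))

lemma measurableSet_cone (σ : Vel d) : MeasurableSet (cone σ) :=
  (measurableSet_lt (f := fun w : Vel d => 9 / 10 * ‖w‖) (by fun_prop) (by fun_prop)).inter
    (measurableSet_lt (g := fun w : Vel d => 99 / 100 * ‖w‖) (by fun_prop) (by fun_prop))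

lemma measurableSet_setOf_mem_cone (w : Vel d) :
    MeasurableSet {σ : USphere d | w ∈ cone (σ : Vel d)} :=
  (measurableSet_lt (f := fun _ : USphere d => 9 / 10 * ‖w‖) (by fun_prop)
    (g := fun σ => inner ℝ w (σ : Vel d)) (by fun_prop)).inter
    (measurableSet_lt (f := fun σ : USphere d => inner ℝ w (σ : Vel d))
      (g := fun _ : USphere d => 99 / 100 * ‖w‖) (by fun_prop) (by fun_prop))

/-- The set of directions seeing a given nonzero vector in their cone has measure bounded below. -/
lemma exists_le_surface_cone (hd : 2 ≤ d) : ∃ κ : ℝ, 0 < κ ∧ ∀ w : Vel d, w ≠ 0 →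
    ENNReal.ofReal κ ≤ surface d {σ | w ∈ cone (σ : Vel d)} := by
  have : Nonempty (Fin d) := ⟨⟨0, by omega⟩⟩
  set c : ℝ≥0∞ := Measure.toSphereBallBound d (1 / 50) * volume (Metric.ball (0 : Vel d) 1) with hc
  have hc0 : 0 < c := by
    refine ENNReal.mul_pos ?_ (Metric.measure_ball_pos _ _ one_pos).ne'
    exact_mod_cast (Measure.toSphereBallBound_pos d (1 / 50)).ne'
  have hct : c ≠ ∞ := ENNReal.mul_ne_top ENNReal.coe_ne_top measure_ball_lt_top.ne
  refine ⟨c.toReal, ENNReal.toReal_pos hc0.ne' hct, fun w hw => ?_⟩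
  rw [ENNReal.ofReal_toReal hct]
  have hw0 : 0 < ‖w‖ := norm_pos_iff.2 hw
  obtain ⟨m, hm, hwm⟩ := exists_unit_orthogonal hd w
  -- The triple 5, 12, 13 gives a unit vector whose cosine with `w` is `12/13`. A spherical ball of
  -- radius `1/50` around it keeps the cosine within `(9/10, 99/100)`.
  set x : Vel d := (12 / 13 * ‖w‖⁻¹) • w + (5 / 13 : ℝ) • m with hx
  have hx1 : ‖x‖ = 1 := by
    have : ‖x‖ ^ 2 = 1 := by
      rw [hx, norm_add_sq_real, norm_smul, norm_smul, inner_smul_left, inner_smul_right, hwm, hm]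
      rw [Real.norm_of_nonneg (by positivity), Real.norm_of_nonneg (by positivity)]
      field_simp; norm_num
    nlinarith [norm_nonneg x]
  have hwx : inner ℝ w x = 12 / 13 * ‖w‖ := by
    rw [hx, inner_add_right, inner_smul_right, inner_smul_right, hwm,
      real_inner_self_eq_norm_sq]
    field_simp; ring
  have key := Measure.toSphereBallBound_mul_measure_unitBall_le_toSphere_ball
    (volume : Measure (Vel d)) (ε := 1 / 50) (by norm_num) ⟨x, by simpa using hx1⟩
  rw [finrank_euclideanSpace, Fintype.card_fin] at key
  refine key.trans (measure_mono fun σ hσ => ?_)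
  have h1 : ‖(σ : Vel d) - x‖ < 1 / 50 := by
    simpa [Subtype.dist_eq, dist_eq_norm] using hσ
  have h2 : |inner ℝ w ((σ : Vel d) - x)| ≤ ‖w‖ * (1 / 50) :=
    (abs_real_inner_le_norm _ _).trans (by gcongr)
  rw [inner_sub_right, hwx, abs_le] at h2
  constructor <;> nlinarith [h2.1, h2.2]

/-- The map `u ↦ (u + |u| σ) / 2`, that is `v_* - v ↦ v' - v`. -/
def halfMap (σ u : Vel d) : Vel d := (1 / 2 : ℝ) • u + (‖u‖ / 2) • σ

lemma lipschitzWith_halfMap {σ : Vel d} (hσ : ‖σ‖ = 1) : LipschitzWith 1 (halfMap σ) := by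
  refine LipschitzWith.of_dist_le_mul fun u v => ?_
  have h : halfMap σ u - halfMap σ v = (1 / 2 : ℝ) • (u - v) + ((‖u‖ - ‖v‖) / 2) • σ := by
    simp only [halfMap]; module
  rw [dist_eq_norm, dist_eq_norm, h]
  refine (norm_add_le _ _).trans ?_
  have h2 : |(‖u‖ - ‖v‖) / 2| = |‖u‖ - ‖v‖| / 2 := by rw [abs_div, abs_two]
  rw [norm_smul, norm_smul, hσ, Real.norm_eq_abs, Real.norm_eq_abs, h2]
  have := abs_norm_sub_norm_le u v
  norm_num
  linarith

/-- Contractions do not increase Hausdorff measure, and by translation invariance Lebesgue measure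
is a multiple of the Hausdorff measure of full dimension. -/
lemma measure_image_le_of_lipschitz {f : Vel d → Vel d} (hf : LipschitzWith 1 f)
    (s : Set (Vel d)) : volume (f '' s) ≤ volume s := by
  have h := (hf.hausdorffMeasure_image_le (d := (Module.finrank ℝ (Vel d) : ℝ)) (by positivity) s)
  simp only [ENNReal.coe_one, ENNReal.one_rpow, one_mul] at h
  rw [Measure.isAddLeftInvariant_eq_smul (volume : Measure (Vel d))
    (Measure.hausdorffMeasure (Module.finrank ℝ (Vel d) : ℝ))]
  simp only [Measure.smul_apply]
  gcongr

/-- A non-expansive map onto a measurable set does not increase integrals. -/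
lemma setLIntegral_le_of_lipschitz {f : Vel d → Vel d} (hf : LipschitzWith 1 f)
    {s : Set (Vel d)} (hs : MeasurableSet s) (hsurj : s ⊆ range f) {H : Vel d → ℝ≥0∞}
    (hH : Measurable H) : ∫⁻ w in s, H w ≤ ∫⁻ u in f ⁻¹' s, H (f u) := by
  have hfm : Measurable f := hf.continuous.measurable
  rw [← setLIntegral_map hs hH hfm]
  -- By surjectivity, a subset of `s` is contained in the image of its preimage; so `volume`
  -- restricted to `s` is at most the pushforward of `volume` by `f`.
  refine lintegral_mono' ?_ le_rfl
  rw [Measure.le_iff]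
  intro t ht
  rw [Measure.restrict_apply ht, Measure.restrict_apply ht, Measure.map_apply hfm (ht.inter hs)]
  refine le_trans (measure_mono ?_) (measure_image_le_of_lipschitz hf _)
  rintro x ⟨hxt, hxs⟩
  obtain ⟨u, rfl⟩ := hsurj hxs
  exact ⟨u, ⟨hxt, hxs⟩, rfl⟩

/-- The explicit preimage follows from `u = 2w - |u| σ` and `|w|² = |u| (w · σ)`. -/
lemma cone_subset_range_halfMap {σ : Vel d} (hσ : ‖σ‖ = 1) : cone σ ⊆ range (halfMap σ) := by
  rintro w ⟨hw1, -⟩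
  have hA : 0 < (inner ℝ w σ : ℝ) := lt_of_le_of_lt (by positivity) hw1
  set A : ℝ := inner ℝ w σ
  refine ⟨(2 : ℝ) • w - (‖w‖ ^ 2 / A) • σ, ?_⟩
  have hn : ‖(2 : ℝ) • w - (‖w‖ ^ 2 / A) • σ‖ = ‖w‖ ^ 2 / A := by
    rw [← sq_eq_sq₀ (norm_nonneg _) (by positivity), norm_sub_sq_real, norm_smul, norm_smul,
      inner_smul_left, inner_smul_right, hσ, Real.norm_of_nonneg (by positivity),
      Real.norm_of_nonneg (by positivity)]
    change _ - 2 * ((2 : ℝ) * (‖w‖ ^ 2 / A * A)) + _ = _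
    field_simp; ring
  rw [halfMap, hn]
  module

/-- The geometry of a collision whose outgoing displacement lies in the cone around `σ`. -/
lemma halfMap_mem_cone {σ u : Vel d} (hσ : ‖σ‖ = 1) (h : halfMap σ u ∈ cone σ) :
    0 < ‖u‖ ∧ ‖u‖ ≤ 10 / 9 * ‖halfMap σ u‖ ∧ |inner ℝ (‖u‖⁻¹ • u) σ| ^ 2 ≤ 93 / 100 ∧
      ‖u - halfMap σ u‖ ^ 2 ≤ ‖halfMap σ u‖ ^ 2 / 4 := by
  set w := halfMap σ u with hw
  have hwu : u = (2 : ℝ) • w - ‖u‖ • σ := by rw [hw, halfMap]; module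
  have hA : (inner ℝ w σ : ℝ) = (inner ℝ u σ + ‖u‖) / 2 := by
    rw [hw, halfMap, inner_add_left, inner_smul_left, inner_smul_left, real_inner_self_eq_norm_sq,
      hσ]
    simp; ring
  -- If `θ` is the angle between `w` and `σ`, then `|w| = |u| cos θ` and the cosine between `u` and
  -- `σ` is `2 cos² θ - 1`. The two bounds of the cone thus control every quantity below.
  have hW : ‖w‖ ^ 2 = ‖u‖ * inner ℝ w σ := by
    rw [hA, hw, halfMap, norm_add_sq_real, norm_smul, norm_smul, inner_smul_left, inner_smul_right,
      hσ, Real.norm_of_nonneg (by positivity), Real.norm_of_nonneg (by positivity)]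
    simp; ring
  have hWu : (inner ℝ u w : ℝ) = ‖w‖ ^ 2 := by
    rw [hW, hA, hw, halfMap, inner_add_right, inner_smul_right, inner_smul_right,
      real_inner_self_eq_norm_sq]
    ring
  obtain ⟨h1, h2⟩ := h
  have hApos : 0 < (inner ℝ w σ : ℝ) := lt_of_le_of_lt (by positivity) h1
  have hu : 0 < ‖u‖ := by
    rcases (norm_nonneg u).eq_or_lt with h0 | h0
    · rw [← h0] at hW hA
      have : u = 0 := norm_eq_zero.1 h0.symm
      rw [hA, this] at hApos
      simp at hApos
    · exact h0
  have hwpos : 0 < ‖w‖ := by nlinarith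
  have hle : ‖u‖ ≤ 10 / 9 * ‖w‖ := by
    by_contra hcon
    push Not at hcon
    nlinarith
  have hge : ‖w‖ ≤ 99 / 100 * ‖u‖ := by
    by_contra hcon
    push Not at hcon
    nlinarith
  refine ⟨hu, hle, ?_, ?_⟩
  · have e1 : (inner ℝ u σ : ℝ) * ‖u‖ = 2 * ‖w‖ ^ 2 - ‖u‖ ^ 2 := by rw [hW, hA]; ring
    have e2 : (inner ℝ (‖u‖⁻¹ • u) σ : ℝ) = 2 * (‖w‖ / ‖u‖) ^ 2 - 1 := by
      rw [inner_smul_left]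
      simp only [conj_trivial]
      field_simp
      linarith
    have h3 : ‖w‖ / ‖u‖ ≤ 99 / 100 := by rw [div_le_iff₀ hu]; exact hge
    have h4 : 9 / 10 ≤ ‖w‖ / ‖u‖ := by rw [le_div_iff₀ hu]; linarith
    have h5 : (‖w‖ / ‖u‖) ^ 2 ≤ (99 / 100) ^ 2 := by gcongr
    have h6 : (9 / 10) ^ 2 ≤ (‖w‖ / ‖u‖) ^ 2 := by gcongr
    rw [e2, sq_abs]
    nlinarith
  -- `u - w` is orthogonal to `w`, so `|u - w|² = |u|² - |w|² ≤ (100/81 - 1)|w|²`, which is below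
  -- `|w|²/4`.
  · rw [norm_sub_sq_real, hWu]
    nlinarith

/-! ### Lower bound of the transition density -/

/-- The Gaussian weight `exp(-7|x|²/4)` bounding the transition density from below. -/
def weight (x : Vel d) : ℝ := Real.exp (-(7 / 4 * ‖x‖ ^ 2))

lemma weight_pos (x : Vel d) : 0 < weight x := Real.exp_pos _

lemma weight_le_one (x : Vel d) : weight x ≤ 1 := by
  unfold weight; rw [Real.exp_le_one_iff]; nlinarith [norm_nonneg x]

@[fun_prop]
lemma measurable_weight : Measurable (weight : Vel d → ℝ) := by unfold weight; fun_prop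

lemma maxwellian_pos (v : Vel d) : 0 < maxwellian d v := by unfold maxwellian; positivity

@[fun_prop]
lemma measurable_maxwellian : Measurable (maxwellian d) := by unfold maxwellian; fun_prop

lemma cosDev_mem (v vs : Vel d) (σ : USphere d) : cosDev v vs σ ∈ Icc (-1 : ℝ) 1 := by
  rw [mem_Icc, ← abs_le]
  refine (abs_real_inner_le_norm _ _).trans ?_
  have hσ : ‖(σ : Vel d)‖ = 1 := by simp
  rw [norm_smul, hσ, mul_one, norm_inv, norm_norm]
  by_cases h : ‖v - vs‖ = 0
  · simp [h]
  · rw [inv_mul_cancel₀ h]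

lemma kernel_nonneg {b : ℝ → ℝ} (hb : IsAngularKernel d b) (γ : ℝ) (v vs : Vel d)
    (σ : USphere d) : 0 ≤ kernel γ b v vs σ :=
  mul_nonneg (by positivity) (hb.nonneg _ (cosDev_mem v vs σ))

lemma measurable_kernel {b : ℝ → ℝ} (hb : IsAngularKernel d b) (γ : ℝ) :
    Measurable fun p : Vel d × Vel d × USphere d => kernel γ b p.1 p.2.1 p.2.2 := by
  have := hb.measurable
  unfold kernel cosDev
  fun_prop

lemma measurable_kernel_right {b : ℝ → ℝ} (hb : IsAngularKernel d b) (γ : ℝ) (v : Vel d) :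
    Measurable fun p : Vel d × USphere d => kernel γ b v p.1 p.2 := by
  have := hb.measurable
  unfold kernel cosDev
  fun_prop

lemma measurable_vPrime_right (v : Vel d) :
    Measurable fun p : Vel d × USphere d => vPrime v p.1 p.2 := by
  unfold vPrime; fun_prop

lemma vPrime_eq (v vs : Vel d) (σ : USphere d) :
    vPrime v vs σ = v + halfMap (σ : Vel d) (vs - v) := by
  rw [vPrime, halfMap, norm_sub_rev v vs]; module

/-- The constant in the pointwise lower bound of the collision kernel. -/
def kernelConst (d : ℕ) (γ b₀ : ℝ) : ℝ :=
  Real.exp (-(3 * γ ^ 2)) * (b₀ * (7 / 100)) * (1 / (2 * Real.pi) ^ ((d : ℝ) / 2))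

lemma kernelConst_pos (d : ℕ) (γ : ℝ) {b₀ : ℝ} (hb₀ : 0 < b₀) : 0 < kernelConst d γ b₀ := by
  unfold kernelConst; positivity

lemma kernel_mul_maxwellian_ge {γ b₀ ν : ℝ} (hγ₀ : γ ≤ 0) (hb₀ : 0 < b₀)
    (hν₁ : ν ≤ 1) {b : ℝ → ℝ}
    (hlow : ∀ x ∈ Ioo (-1 : ℝ) 1, b₀ * (1 - |x| ^ 2) ^ (ν / 2) ≤ b x)
    {v vs : Vel d} {σ : USphere d} (h : halfMap (σ : Vel d) (vs - v) ∈ cone (σ : Vel d)) :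
    kernelConst d γ b₀ * (weight v * weight (vPrime v vs σ)) ≤
      kernel γ b v vs σ * maxwellian d vs := by
  have hσ : ‖(σ : Vel d)‖ = 1 := by simp
  obtain ⟨hu, hle, hcos, hy⟩ := halfMap_mem_cone hσ h
  set u := vs - v with hudef
  set w := halfMap (σ : Vel d) u with hw
  have hcosdev : |cosDev v vs σ| ^ 2 ≤ 93 / 100 := by
    have : cosDev v vs σ = -inner ℝ (‖u‖⁻¹ • u) (σ : Vel d) := by
      rw [cosDev, ← neg_sub vs v, norm_neg, smul_neg, inner_neg_left]
    rw [this, abs_neg]; exact hcos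
  -- `7/100 = 1 - 93/100`; since `ν/2 ≤ 1`, the power of a number in `[0, 1]` is at least that
  -- number.
  have hb : b₀ * (7 / 100) ≤ b (cosDev v vs σ) := by
    have hx : cosDev v vs σ ∈ Ioo (-1 : ℝ) 1 := by
      rw [mem_Ioo, ← abs_lt]; nlinarith [abs_nonneg (cosDev v vs σ)]
    refine le_trans ?_ (hlow _ hx)
    gcongr
    have h1 : (1 - |cosDev v vs σ| ^ 2) ^ (1 : ℝ) ≤ (1 - |cosDev v vs σ| ^ 2) ^ (ν / 2) :=
      Real.rpow_le_rpow_of_exponent_ge (by linarith) (by nlinarith [abs_nonneg (cosDev v vs σ)])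
        (by linarith)
    rw [Real.rpow_one] at h1
    linarith
  -- The decay of `|u|^γ` at infinity is absorbed in a Gaussian: `log |u| ≤ |u| ≤ 10|w|/9`, and
  -- Young's inequality splits `γ|w|`.
  have hpow : Real.exp (-(3 * γ ^ 2)) * Real.exp (-(‖w‖ ^ 2 / 8)) ≤ ‖v - vs‖ ^ γ := by
    rw [norm_sub_rev, ← hudef, Real.rpow_def_of_pos hu, ← Real.exp_add, Real.exp_le_exp]
    have h1 : Real.log ‖u‖ ≤ ‖u‖ := (Real.log_le_sub_one_of_pos hu).trans (by linarith)
    have h2 : Real.log ‖u‖ ≤ 10 / 9 * ‖w‖ := h1.trans hle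
    nlinarith [sq_nonneg (‖w‖ / 4 + 20 / 9 * γ), mul_le_mul_of_nonpos_right h2 hγ₀]
  have hwn : ‖w‖ ^ 2 ≤ 2 * ‖vPrime v vs σ‖ ^ 2 + 2 * ‖v‖ ^ 2 := by
    have : w = vPrime v vs σ - v := by rw [vPrime_eq]; simp [hw, hudef]
    rw [this]
    have := parallelogram_law_with_norm ℝ (vPrime v vs σ) v
    nlinarith [norm_nonneg (vPrime v vs σ + v), this]
  have hvs : ‖vs‖ ^ 2 ≤ 2 * ‖vPrime v vs σ‖ ^ 2 + ‖w‖ ^ 2 / 2 := by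
    have e : vs = vPrime v vs σ + (u - w) := by rw [vPrime_eq]; simp [hw, hudef]
    have := parallelogram_law_with_norm ℝ (vPrime v vs σ) (u - w)
    rw [← e] at this
    nlinarith [norm_nonneg (vPrime v vs σ - (u - w)), this]
  -- Source of the exponent `7/4`: `|w|²/8 + |v_*|²/2 ≤ |v'|² + 3|w|²/8 ≤ 7|v'|²/4 + 3|v|²/4`.
  have hexp : weight v * weight (vPrime v vs σ) ≤
      Real.exp (-(‖w‖ ^ 2 / 8)) * Real.exp (-(‖vs‖ ^ 2) / 2) := by
    unfold weight
    rw [← Real.exp_add, ← Real.exp_add, Real.exp_le_exp]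
    nlinarith [sq_nonneg ‖v‖]
  calc _ ≤ kernelConst d γ b₀ *
        (Real.exp (-(‖w‖ ^ 2 / 8)) * Real.exp (-(‖vs‖ ^ 2) / 2)) := by
        gcongr
        exact (kernelConst_pos d γ hb₀).le
    _ = (Real.exp (-(3 * γ ^ 2)) * Real.exp (-(‖w‖ ^ 2 / 8))) * (b₀ * (7 / 100)) *
        maxwellian d vs := by unfold kernelConst maxwellian; ring
    _ ≤ _ := by
        unfold kernel
        have := (maxwellian_pos vs).le
        gcongr

/-- The transition density of a collision with the Maxwellian background is bounded below. -/
lemma exists_transition_ge (hd : 2 ≤ d) {γ b₀ ν : ℝ} (hγ₀ : γ ≤ 0) (hb₀ : 0 < b₀)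
    (hν₁ : ν ≤ 1) : ∃ κ : ℝ, 0 < κ ∧ ∀ b : ℝ → ℝ, IsAngularKernel d b →
      (∀ x ∈ Ioo (-1 : ℝ) 1, b₀ * (1 - |x| ^ 2) ^ (ν / 2) ≤ b x) →
      ∀ φ : Vel d → ℝ≥0∞, Measurable φ → ∀ v : Vel d,
      ENNReal.ofReal (κ * weight v) * ∫⁻ x, ENNReal.ofReal (weight x) * φ x ≤
        ∫⁻ p : Vel d × USphere d, ENNReal.ofReal (kernel γ b v p.1 p.2 * maxwellian d p.1) *
          φ (vPrime v p.1 p.2) ∂(volume.prod (surface d)) := by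
  obtain ⟨κ₁, hκ₁, hcone⟩ := exists_le_surface_cone hd
  have hκ₀ := kernelConst_pos d γ hb₀
  refine ⟨kernelConst d γ b₀ * κ₁, by positivity, fun b hb hlow φ hφ v => ?_⟩
  have : Nonempty (Fin d) := ⟨⟨0, by omega⟩⟩
  obtain ⟨H, hH⟩ : ∃ H : Vel d → ℝ≥0∞, H = fun w =>
      ENNReal.ofReal (kernelConst d γ b₀ * (weight v * weight (v + w))) * φ (v + w) := ⟨_, rfl⟩
  have hHm : Measurable H := by rw [hH]; fun_prop
  have hm1 : Measurable fun p : Vel d × USphere d =>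
      ENNReal.ofReal (kernel γ b v p.1 p.2 * maxwellian d p.1) * φ (vPrime v p.1 p.2) := by
    exact ((measurable_kernel_right hb γ v).mul
      (measurable_maxwellian.comp measurable_fst)).ennreal_ofReal.mul
      (hφ.comp (measurable_vPrime_right v))
  have hm2 : Measurable fun p : USphere d × Vel d => (cone (p.1 : Vel d)).indicator H p.2 :=
    Measurable.indicator (f := fun p : USphere d × Vel d => H p.2) (by fun_prop)
      measurableSet_cone_prod
  calc _ = ∫⁻ w, H w * ENNReal.ofReal κ₁ := by
        rw [lintegral_mul_const _ hHm, hH]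
        rw [lintegral_add_left_eq_self (fun x => ENNReal.ofReal
          (kernelConst d γ b₀ * (weight v * weight x)) * φ x) v]
        have e : ∀ x : Vel d, ENNReal.ofReal (kernelConst d γ b₀ * (weight v * weight x)) * φ x
            = ENNReal.ofReal (kernelConst d γ b₀ * weight v) *
              (ENNReal.ofReal (weight x) * φ x) := by
          intro x
          rw [← mul_assoc (kernelConst d γ b₀), ENNReal.ofReal_mul
            (mul_nonneg hκ₀.le (weight_pos v).le), mul_assoc]
        simp_rw [e]
        rw [lintegral_const_mul _ (by fun_prop), mul_right_comm,
          ENNReal.ofReal_mul (mul_nonneg hκ₀.le (weight_pos v).le)]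
        ring
    -- The constant `κ₁` is traded for the directions `σ` whose cone contains `w`. After exchanging
    -- the integrals, `σ` is fixed and `w` is replaced by `halfMap σ u`.
    _ ≤ ∫⁻ w, ∫⁻ σ : USphere d, (cone (σ : Vel d)).indicator H w ∂(surface d) := by
        refine lintegral_mono_ae ?_
        filter_upwards [(volume : Measure (Vel d)).ae_ne 0] with w hw
        have e : ∀ σ : USphere d, (cone (σ : Vel d)).indicator H w =
            {σ : USphere d | w ∈ cone (σ : Vel d)}.indicator (fun _ => H w) σ := by
          intro σ; simp [indicator]
        simp_rw [e]
        rw [lintegral_indicator_const (measurableSet_setOf_mem_cone w)]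
        gcongr
        exact hcone w hw
    _ = ∫⁻ σ : USphere d, (∫⁻ w, (cone (σ : Vel d)).indicator H w) ∂(surface d) :=
        (lintegral_lintegral_swap (f := fun (σ : USphere d) w => (cone (σ : Vel d)).indicator H w)
          hm2.aemeasurable).symm
    _ ≤ ∫⁻ σ : USphere d, (∫⁻ vs, ENNReal.ofReal (kernel γ b v vs σ * maxwellian d vs) *
          φ (vPrime v vs σ)) ∂(surface d) := by
        refine lintegral_mono fun σ => ?_
        have hσ : ‖(σ : Vel d)‖ = 1 := by simp
        rw [lintegral_indicator (measurableSet_cone _), ← lintegral_add_left_eq_self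
          (fun vs => ENNReal.ofReal (kernel γ b v vs σ * maxwellian d vs) * φ (vPrime v vs σ)) v]
        refine (setLIntegral_le_of_lipschitz (lipschitzWith_halfMap hσ) (measurableSet_cone _)
          (cone_subset_range_halfMap hσ) hHm).trans ?_
        refine le_trans ?_ (setLIntegral_le_lintegral
          (halfMap (σ : Vel d) ⁻¹' cone (σ : Vel d)) _)
        refine setLIntegral_mono' ((measurableSet_cone _).preimage
          (lipschitzWith_halfMap hσ).continuous.measurable) fun u hu => ?_
        have e : vPrime v (v + u) σ = v + halfMap (σ : Vel d) u := by
          rw [vPrime_eq, add_sub_cancel_left]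
        have hker := kernel_mul_maxwellian_ge (v := v) (vs := v + u) (σ := σ) hγ₀ hb₀ hν₁ hlow
          (by rw [add_sub_cancel_left]; exact hu)
        rw [e] at hker
        simp only [hH, e]
        gcongr
    _ = _ := by rw [lintegral_prod_symm _ hm1.aemeasurable]

/-! ### Integrability and bounds of the collision frequency -/

lemma integrable_exp_neg_mul_norm_sq {c : ℝ} (hc : 0 < c) :
    Integrable fun v : Vel d => Real.exp (-(c * ‖v‖ ^ 2)) := by
  have h := (GaussianFourier.integrable_cexp_neg_mul_sq_norm_add (V := Vel d) (b := (c : ℂ))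
    (by simpa using hc) 0 0).norm
  refine h.congr (Filter.Eventually.of_forall fun v => ?_)
  simp only [Complex.norm_exp]
  congr 1
  simp [← Complex.ofReal_pow]

lemma integrable_weight : Integrable (weight : Vel d → ℝ) :=
  integrable_exp_neg_mul_norm_sq (by norm_num)

lemma integrable_maxwellian : Integrable (maxwellian d) := by
  have h := (integrable_exp_neg_mul_norm_sq (d := d) (c := 1 / 2) (by norm_num)).const_mul
    (1 / (2 * Real.pi) ^ ((d : ℝ) / 2))
  refine h.congr (Filter.Eventually.of_forall fun v => ?_)
  simp only [maxwellian]
  congr 2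
  ring

lemma maxwellian_le_one (v : Vel d) : maxwellian d v ≤ 1 := by
  unfold maxwellian
  have h1 : (1 : ℝ) ≤ (2 * Real.pi) ^ ((d : ℝ) / 2) :=
    Real.one_le_rpow (by linarith [Real.pi_gt_three]) (by positivity)
  have h2 : Real.exp (-(‖v‖ ^ 2) / 2) ≤ 1 := by
    rw [Real.exp_le_one_iff]; nlinarith [norm_nonneg v]
  have h3 : 1 / (2 * Real.pi) ^ ((d : ℝ) / 2) ≤ 1 := by
    rw [div_le_one (by positivity)]; exact h1
  have h4 := Real.exp_pos (-(‖v‖ ^ 2) / 2)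
  nlinarith

/-- A bound of the collision frequency, uniform in the angular kernel. -/
def freqBound (d : ℕ) (γ : ℝ) : ℝ≥0∞ :=
  (∫⁻ u in Metric.ball (0 : Vel d) 1, ENNReal.ofReal (‖u‖ ^ γ)) +
    ∫⁻ v, ENNReal.ofReal (maxwellian d v)

lemma freqBound_ne_top (hd : d ≠ 0) {γ : ℝ} (hγ : -(d : ℝ) < γ) : freqBound d γ ≠ ∞ := by
  have : Nonempty (Fin d) := ⟨⟨0, Nat.pos_of_ne_zero hd⟩⟩
  refine ENNReal.add_ne_top.2 ⟨?_, ?_⟩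
  · have h : IntegrableOn (fun u : Vel d => ‖u‖ ^ γ) (Metric.ball 0 1) := by
      rw [integrableOn_fun_norm_addHaar volume (f := fun r : ℝ => r ^ γ)]
      have h1 : IntegrableOn (fun r : ℝ => r ^ ((d : ℝ) - 1 + γ)) (Ioo 0 1) := by
        have := (intervalIntegral.intervalIntegrable_rpow' (a := 0) (b := 1)
          (r := (d : ℝ) - 1 + γ) (by linarith))
        rw [intervalIntegrable_iff_integrableOn_Ioo_of_le zero_le_one] at this
        exact this
      refine h1.congr_fun (fun r hr => ?_) measurableSet_Ioo
      have hd1 : ((Module.finrank ℝ (Vel d) - 1 : ℕ) : ℝ) = (d : ℝ) - 1 := by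
        rw [finrank_euclideanSpace, Fintype.card_fin, Nat.cast_sub (Nat.one_le_iff_ne_zero.2 hd)]
        simp
      simp only [smul_eq_mul]
      rw [← Real.rpow_natCast, hd1, ← Real.rpow_add hr.1]
    exact h.lintegral_lt_top.ne
  · exact integrable_maxwellian.lintegral_lt_top.ne

lemma lintegral_angular {b : ℝ → ℝ} (hb : IsAngularKernel d b) {e : Vel d} (he : ‖e‖ = 1) :
    ∫⁻ σ : USphere d, ENNReal.ofReal (b (inner ℝ e (σ : Vel d))) ∂(surface d) = 1 := by
  have h := hb.norm_eq_one e he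
  have hi : Integrable (fun σ : USphere d => b (inner ℝ e (σ : Vel d))) (surface d) := by
    by_contra hn
    rw [integral_undef hn] at h
    exact zero_ne_one h
  rw [← ofReal_integral_eq_lintegral_ofReal hi, h, ENNReal.ofReal_one]
  refine Filter.Eventually.of_forall fun σ => hb.nonneg _ ?_
  rw [mem_Icc, ← abs_le]
  have hσ : ‖(σ : Vel d)‖ = 1 := by simp
  simpa [he, hσ] using abs_real_inner_le_norm e (σ : Vel d)

lemma measurable_kernel_mul_maxwellian {b : ℝ → ℝ} (hb : IsAngularKernel d b) (γ : ℝ)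
    (v : Vel d) : Measurable fun p : Vel d × USphere d =>
      kernel γ b v p.1 p.2 * maxwellian d p.1 :=
  (measurable_kernel_right hb γ v).mul (measurable_maxwellian.comp measurable_fst)

/-- The angular integral is `1`, which removes `b`. Near `v_* = v` the Maxwellian is bounded by `1`
and `|u|^γ` is locally integrable; away from it `|u|^γ ≤ 1`. The bound is independent of `b`, as the
final constant must be. -/
lemma lintegral_kernel_le (hd : d ≠ 0) {γ : ℝ} (hγ₀ : γ ≤ 0) {b : ℝ → ℝ}
    (hb : IsAngularKernel d b) (v : Vel d) :
    ∫⁻ p : Vel d × USphere d, ENNReal.ofReal (kernel γ b v p.1 p.2 * maxwellian d p.1)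
      ∂(volume.prod (surface d)) ≤ freqBound d γ := by
  have : Nonempty (Fin d) := ⟨⟨0, Nat.pos_of_ne_zero hd⟩⟩
  have hm := (measurable_kernel_mul_maxwellian hb γ v).ennreal_ofReal
  calc _ = ∫⁻ vs, ∫⁻ σ : USphere d, ENNReal.ofReal (kernel γ b v vs σ * maxwellian d vs)
        ∂(surface d) := lintegral_prod _ hm.aemeasurable
    _ = ∫⁻ vs, ENNReal.ofReal (‖v - vs‖ ^ γ * maxwellian d vs) := by
        refine lintegral_congr_ae ?_
        filter_upwards [(volume : Measure (Vel d)).ae_ne v] with vs hvs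
        have hne : ‖v - vs‖ ≠ 0 := norm_ne_zero_iff.2 (sub_ne_zero.2 hvs.symm)
        have he : ‖‖v - vs‖⁻¹ • (v - vs)‖ = 1 := by
          rw [norm_smul, norm_inv, norm_norm, inv_mul_cancel₀ hne]
        have e : ∀ σ : USphere d, ENNReal.ofReal (kernel γ b v vs σ * maxwellian d vs) =
            ENNReal.ofReal (‖v - vs‖ ^ γ * maxwellian d vs) *
              ENNReal.ofReal (b (inner ℝ (‖v - vs‖⁻¹ • (v - vs)) (σ : Vel d))) := by
          intro σ
          rw [← ENNReal.ofReal_mul (mul_nonneg (by positivity) (maxwellian_pos vs).le)]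
          congr 1
          simp only [kernel, cosDev]
          ring
        simp_rw [e]
        rw [lintegral_const_mul' _ _ ENNReal.ofReal_ne_top, lintegral_angular hb he, mul_one]
    _ ≤ ∫⁻ vs, ({vs : Vel d | v - vs ∈ Metric.ball (0 : Vel d) 1}.indicator
          (fun vs => ENNReal.ofReal (‖v - vs‖ ^ γ)) vs + ENNReal.ofReal (maxwellian d vs)) := by
        refine lintegral_mono fun vs => ?_
        by_cases h : ‖v - vs‖ < 1
        · rw [indicator_of_mem (by simpa using h)]
          refine le_add_right (ENNReal.ofReal_le_ofReal ?_)
          exact mul_le_of_le_one_right (by positivity) (maxwellian_le_one vs)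
        · refine le_add_left (ENNReal.ofReal_le_ofReal ?_)
          refine mul_le_of_le_one_left (maxwellian_pos vs).le ?_
          exact Real.rpow_le_one_of_one_le_of_nonpos (not_lt.1 h) hγ₀
    _ = freqBound d γ := by
        rw [lintegral_add_right _ measurable_maxwellian.ennreal_ofReal, freqBound]
        congr 1
        rw [← lintegral_indicator Metric.isOpen_ball.measurableSet,
          ← lintegral_sub_left_eq_self _ v]
        simp [indicator]

lemma integrable_kernel (hd : d ≠ 0) {γ : ℝ} (hγ : -(d : ℝ) < γ) (hγ₀ : γ ≤ 0) {b : ℝ → ℝ}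
    (hb : IsAngularKernel d b) (v : Vel d) :
    Integrable (fun p : Vel d × USphere d => kernel γ b v p.1 p.2 * maxwellian d p.1)
      (volume.prod (surface d)) := by
  refine ⟨(measurable_kernel_mul_maxwellian hb γ v).aestronglyMeasurable, ?_⟩
  rw [hasFiniteIntegral_iff_ofReal (Filter.Eventually.of_forall fun p =>
    mul_nonneg (kernel_nonneg hb γ _ _ _) (maxwellian_pos _).le)]
  exact (lintegral_kernel_le hd hγ₀ hb v).trans_lt (freqBound_ne_top hd hγ).lt_top

lemma collisionFreq_nonneg {b : ℝ → ℝ} (hb : IsAngularKernel d b) (γ : ℝ) (v : Vel d) :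
    0 ≤ collisionFreq γ b v :=
  integral_nonneg fun _ => mul_nonneg (kernel_nonneg hb γ _ _ _) (maxwellian_pos _).le

lemma collisionFreq_le (hd : d ≠ 0) {γ : ℝ} (hγ : -(d : ℝ) < γ) (hγ₀ : γ ≤ 0) {b : ℝ → ℝ}
    (hb : IsAngularKernel d b) (v : Vel d) : collisionFreq γ b v ≤ (freqBound d γ).toReal := by
  unfold collisionFreq
  rw [integral_eq_lintegral_of_nonneg_ae (Filter.Eventually.of_forall fun p =>
    mul_nonneg (kernel_nonneg hb γ _ _ _) (maxwellian_pos _).le)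
    (measurable_kernel_mul_maxwellian hb γ v).aestronglyMeasurable]
  exact ENNReal.toReal_mono (freqBound_ne_top hd hγ) (lintegral_kernel_le hd hγ₀ hb v)

lemma collisionFreq_le_norm (hd : d ≠ 0) {γ : ℝ} (hγ : -(d : ℝ) < γ) (hγ₀ : γ ≤ 0) {b : ℝ → ℝ}
    (hb : IsAngularKernel d b) (v : Vel d) : collisionFreq γ b v ≤ collisionFreqNorm d γ b := by
  refine (le_abs_self _).trans (le_ciSup (f := fun v => |collisionFreq γ b v|) ⟨(freqBound d γ).toReal, ?_⟩ v)
  rintro _ ⟨w, rfl⟩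
  simp only [abs_of_nonneg (collisionFreq_nonneg hb γ w)]
  exact collisionFreq_le hd hγ hγ₀ hb w

lemma collisionFreqNorm_le (hd : d ≠ 0) {γ : ℝ} (hγ : -(d : ℝ) < γ) (hγ₀ : γ ≤ 0) {b : ℝ → ℝ}
    (hb : IsAngularKernel d b) : collisionFreqNorm d γ b ≤ (freqBound d γ).toReal := by
  refine ciSup_le fun v => ?_
  rw [abs_of_nonneg (collisionFreq_nonneg hb γ v)]
  exact collisionFreq_le hd hγ hγ₀ hb v

lemma collisionFreqNorm_nonneg (d : ℕ) (γ : ℝ) (b : ℝ → ℝ) : 0 ≤ collisionFreqNorm d γ b :=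
  Real.iSup_nonneg fun _ => abs_nonneg _

/-! ### Weak form of the collision operator -/

/-- The loss density `|v - v_*|^γ b(cos θ) g(v) M(v_*)` on the space of collisions. -/
def lossDensity (γ : ℝ) (b : ℝ → ℝ) (g : Vel d → ℝ) (p : Vel d × Vel d × USphere d) : ℝ :=
  kernel γ b p.1 p.2.1 p.2.2 * (g p.1 * maxwellian d p.2.1)

/-- The gain density `|v - v_*|^γ b(cos θ) g(v') M(v'_*)` on the space of collisions. -/
def gainDensity (γ : ℝ) (b : ℝ → ℝ) (g : Vel d → ℝ) (p : Vel d × Vel d × USphere d) : ℝ :=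
  kernel γ b p.1 p.2.1 p.2.2 *
    (g (vPrime p.1 p.2.1 p.2.2) * maxwellian d (vsPrime p.1 p.2.1 p.2.2))

lemma lossDensity_eq (γ : ℝ) (b : ℝ → ℝ) (g : Vel d → ℝ) (v : Vel d) (q : Vel d × USphere d) :
    lossDensity γ b g (v, q) = g v * (kernel γ b v q.1 q.2 * maxwellian d q.1) := by
  simp only [lossDensity]; ring

lemma aestronglyMeasurable_lossDensity {γ : ℝ} {b : ℝ → ℝ} (hb : IsAngularKernel d b)
    {g : Vel d → ℝ} (hg : AEStronglyMeasurable g volume) :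
    AEStronglyMeasurable (lossDensity γ b g) (collMeasure d) := by
  have h1 : AEStronglyMeasurable (fun p : Vel d × Vel d × USphere d => g p.1) (collMeasure d) :=
    hg.comp_fst
  have h2 : Measurable fun p : Vel d × Vel d × USphere d => maxwellian d p.2.1 :=
    measurable_maxwellian.comp (by fun_prop)
  exact (measurable_kernel hb γ).aestronglyMeasurable.mul (h1.mul h2.aestronglyMeasurable)

lemma integrable_lossDensity (hd : d ≠ 0) {γ : ℝ} (hγ : -(d : ℝ) < γ) (hγ₀ : γ ≤ 0) {b : ℝ → ℝ}
    (hb : IsAngularKernel d b) {g : Vel d → ℝ} (hg : Integrable g) :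
    Integrable (lossDensity γ b g) (collMeasure d) := by
  rw [integrable_prod_iff (aestronglyMeasurable_lossDensity hb hg.1)]
  simp only [lossDensity_eq]
  refine ⟨Filter.Eventually.of_forall fun v => (integrable_kernel hd hγ hγ₀ hb v).const_mul _, ?_⟩
  have e : ∀ v, ∫ q : Vel d × USphere d, ‖g v * (kernel γ b v q.1 q.2 * maxwellian d q.1)‖
      ∂(volume.prod (surface d)) = ‖g v‖ * collisionFreq γ b v := by
    intro v
    rw [collisionFreq, ← integral_const_mul]
    refine integral_congr_ae (Filter.Eventually.of_forall fun q => ?_)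
    simp only [norm_mul]
    rw [Real.norm_of_nonneg (kernel_nonneg hb γ _ _ _), Real.norm_of_nonneg (maxwellian_pos _).le]
  simp only [e]
  refine hg.norm.mul_bdd (c := (freqBound d γ).toReal) ?_ (Filter.Eventually.of_forall fun v => ?_)
  · have hm : StronglyMeasurable fun p : Vel d × Vel d × USphere d =>
        kernel γ b p.1 p.2.1 p.2.2 * maxwellian d p.2.1 :=
      ((measurable_kernel hb γ).mul (measurable_maxwellian.comp (by fun_prop))).stronglyMeasurable
    exact hm.integral_prod_right'.aestronglyMeasurable
  · rw [Real.norm_of_nonneg (collisionFreq_nonneg hb γ v)]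
    exact collisionFreq_le hd hγ hγ₀ hb v

lemma gainDensity_ae_eq (e₀ : USphere d) (γ : ℝ) (b : ℝ → ℝ) (g : Vel d → ℝ) :
    gainDensity γ b g =ᵐ[collMeasure d] lossDensity γ b g ∘ collMap e₀ := by
  filter_upwards [ae_ne (ne_zero_of_sphere e₀)] with p hp
  simp only [Function.comp, lossDensity, gainDensity, collMap, kernel_collMap γ b e₀ hp]

lemma integrable_gainDensity (hd : d ≠ 0) (e₀ : USphere d) {γ : ℝ} (hγ : -(d : ℝ) < γ)
    (hγ₀ : γ ≤ 0) {b : ℝ → ℝ} (hb : IsAngularKernel d b) {g : Vel d → ℝ} (hg : Integrable g) :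
    Integrable (gainDensity γ b g) (collMeasure d) :=
  (((measurePreserving_collMap e₀).integrable_comp
    (aestronglyMeasurable_lossDensity hb hg.1)).2
      (integrable_lossDensity hd hγ hγ₀ hb hg)).congr (gainDensity_ae_eq e₀ γ b g).symm

/-- Weak form of the gain term. -/
lemma setIntegral_gainDensity (e₀ : USphere d) {γ : ℝ} {b : ℝ → ℝ} (hb : IsAngularKernel d b)
    {g : Vel d → ℝ} (hg : Integrable g) {B : Set (Vel d)} (hB : MeasurableSet B) :
    ∫ p, B.indicator 1 p.1 * gainDensity γ b g p ∂(collMeasure d) =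
      ∫ p, B.indicator 1 (vPrime p.1 p.2.1 p.2.2) * lossDensity γ b g p ∂(collMeasure d) := by
  have hm : AEStronglyMeasurable (fun p : Vel d × Vel d × USphere d =>
      B.indicator (1 : Vel d → ℝ) (vPrime p.1 p.2.1 p.2.2) * lossDensity γ b g p)
      (collMeasure d) :=
    ((measurable_one.indicator hB).comp measurable_vPrime).aestronglyMeasurable.mul
      (aestronglyMeasurable_lossDensity hb hg.1)
  have hT := measurePreserving_collMap e₀
  -- Only the right side is pulled back by the involution: the loss density becomes the gain
  -- density, and applying the map twice returns `v'` to `v`.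
  conv_rhs => rw [← hT.map_eq]
  rw [integral_map hT.measurable.aemeasurable (by rwa [hT.map_eq])]
  refine integral_congr_ae ?_
  filter_upwards [gainDensity_ae_eq e₀ γ b g, ae_ne (ne_zero_of_sphere e₀)] with p h1 h2
  have h3 : vPrime (collMap e₀ p).1 (collMap e₀ p).2.1 (collMap e₀ p).2.2 = p.1 :=
    congrArg Prod.fst (collMap_collMap e₀ h2 p.2.2)
  rw [h1, h3, Function.comp]

lemma linOp_eq (γ : ℝ) (b : ℝ → ℝ) (g : Vel d → ℝ) (v : Vel d) :
    linOp γ b g v = ∫ q, (gainDensity γ b g (v, q) - lossDensity γ b g (v, q))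
      ∂(volume.prod (surface d)) := by
  simp only [linOp, collision, gainDensity, lossDensity, mul_sub]

lemma integrable_linOp (hd : d ≠ 0) (e₀ : USphere d) {γ : ℝ} (hγ : -(d : ℝ) < γ)
    (hγ₀ : γ ≤ 0) {b : ℝ → ℝ} (hb : IsAngularKernel d b) {g : Vel d → ℝ} (hg : Integrable g) :
    Integrable (linOp γ b g) := by
  have h := ((integrable_gainDensity hd e₀ hγ hγ₀ hb hg).sub
    (integrable_lossDensity hd hγ hγ₀ hb hg)).integral_prod_left
  exact h.congr (Filter.Eventually.of_forall fun v => (linOp_eq γ b g v).symm)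

/-- Weak form of the collision operator. -/
lemma setIntegral_linOp (hd : d ≠ 0) (e₀ : USphere d) {γ : ℝ} (hγ : -(d : ℝ) < γ)
    (hγ₀ : γ ≤ 0) {b : ℝ → ℝ} (hb : IsAngularKernel d b) {g : Vel d → ℝ} (hg : Integrable g)
    {B : Set (Vel d)} (hB : MeasurableSet B) :
    ∫ v in B, linOp γ b g v =
      (∫ v, g v * (∫ q : Vel d × USphere d, B.indicator 1 (vPrime v q.1 q.2) *
        (kernel γ b v q.1 q.2 * maxwellian d q.1) ∂(volume.prod (surface d)))) -
      ∫ v in B, g v * collisionFreq γ b v := by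
  have hgain := integrable_gainDensity hd e₀ hγ hγ₀ hb hg
  have hloss := integrable_lossDensity hd hγ hγ₀ hb hg
  have hind : Measurable (B.indicator (1 : Vel d → ℝ)) := measurable_one.indicator hB
  have hbd : ∀ x, ‖B.indicator (1 : Vel d → ℝ) x‖ ≤ 1 := fun x => by
    by_cases hx : x ∈ B <;> simp [hx]
  have i1 : Integrable (fun p => B.indicator 1 p.1 * gainDensity γ b g p) (collMeasure d) :=
    hgain.bdd_mul (c := 1) (hind.comp measurable_fst).aestronglyMeasurable
      (Filter.Eventually.of_forall fun p => hbd _)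
  have i2 : Integrable (fun p => B.indicator 1 p.1 * lossDensity γ b g p) (collMeasure d) :=
    hloss.bdd_mul (c := 1) (hind.comp measurable_fst).aestronglyMeasurable
      (Filter.Eventually.of_forall fun p => hbd _)
  have i3 : Integrable (fun p : Vel d × Vel d × USphere d =>
      B.indicator 1 (vPrime p.1 p.2.1 p.2.2) * lossDensity γ b g p) (collMeasure d) :=
    hloss.bdd_mul (c := 1) (hind.comp measurable_vPrime).aestronglyMeasurable
      (Filter.Eventually.of_forall fun p => hbd _)
  -- Gain and loss sit under one integral in `linOp`, and for a given `v` the gain need not be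
  -- integrable. They are therefore separated only after Fubini, on the whole collision space.
  calc ∫ v in B, linOp γ b g v
      = ∫ v, ∫ q, (B.indicator 1 v * gainDensity γ b g (v, q) -
          B.indicator 1 v * lossDensity γ b g (v, q)) ∂(volume.prod (surface d)) := by
        rw [← integral_indicator hB]
        refine integral_congr_ae (Filter.Eventually.of_forall fun v => ?_)
        by_cases hv : v ∈ B <;> simp [hv, linOp_eq]
    _ = ∫ p, (B.indicator 1 p.1 * gainDensity γ b g p - B.indicator 1 p.1 * lossDensity γ b g p)
          ∂(collMeasure d) := (integral_prod _ (i1.sub i2)).symm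
    _ = ∫ p, B.indicator 1 (vPrime p.1 p.2.1 p.2.2) * lossDensity γ b g p ∂(collMeasure d) -
          ∫ p, B.indicator 1 p.1 * lossDensity γ b g p ∂(collMeasure d) := by
        rw [integral_sub i1 i2, setIntegral_gainDensity e₀ hb hg hB]
    _ = _ := by
        rw [integral_prod _ i3, integral_prod _ i2, ← integral_indicator hB]
        congr 1
        · refine integral_congr_ae (Filter.Eventually.of_forall fun v => ?_)
          simp only [lossDensity_eq]
          rw [← integral_const_mul]
          refine integral_congr_ae (Filter.Eventually.of_forall fun q => ?_)
          ring_nf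
        · refine integral_congr_ae (Filter.Eventually.of_forall fun v => ?_)
          simp only [lossDensity_eq]
          by_cases hv : v ∈ B
          · simp [hv, collisionFreq, integral_const_mul]
          · simp [hv]

/-- Conservation of mass. -/
lemma integral_linOp (hd : d ≠ 0) (e₀ : USphere d) {γ : ℝ} (hγ : -(d : ℝ) < γ)
    (hγ₀ : γ ≤ 0) {b : ℝ → ℝ} (hb : IsAngularKernel d b) {g : Vel d → ℝ} (hg : Integrable g) :
    ∫ v, linOp γ b g v = 0 := by
  have h := setIntegral_linOp hd e₀ hγ hγ₀ hb hg MeasurableSet.univ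
  simp only [setIntegral_univ, indicator_univ, Pi.one_apply, one_mul] at h
  rw [h]
  simp only [collisionFreq, sub_self]

/-- The collision operator is additive almost everywhere. -/
lemma linOp_add_ae (hd : d ≠ 0) (e₀ : USphere d) {γ : ℝ} (hγ : -(d : ℝ) < γ)
    (hγ₀ : γ ≤ 0) {b : ℝ → ℝ} (hb : IsAngularKernel d b) {g₁ g₂ g : Vel d → ℝ}
    (hg₁ : Integrable g₁) (hg₂ : Integrable g₂) (h : g =ᵐ[volume] g₁ + g₂) :
    linOp γ b g =ᵐ[volume] linOp γ b g₁ + linOp γ b g₂ := by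
  -- The operator evaluates `g` at `v'`, so changing `g` on a null set is harmless only because
  -- preimages of null sets under `v'` are null.
  have hq : Measure.QuasiMeasurePreserving
      (fun p : Vel d × Vel d × USphere d => vPrime p.1 p.2.1 p.2.2) (collMeasure d) volume :=
    (Measure.quasiMeasurePreserving_fst (μ := (volume : Measure (Vel d)))
      (ν := volume.prod (surface d))).comp (measurePreserving_collMap e₀).quasiMeasurePreserving
  have h' := Measure.ae_ae_of_ae_prod (hq.ae h)
  have j₁ := ((integrable_gainDensity hd e₀ hγ hγ₀ hb hg₁).sub
    (integrable_lossDensity hd hγ hγ₀ hb hg₁)).prod_right_ae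
  have j₂ := ((integrable_gainDensity hd e₀ hγ hγ₀ hb hg₂).sub
    (integrable_lossDensity hd hγ hγ₀ hb hg₂)).prod_right_ae
  filter_upwards [h, h', j₁, j₂] with v hv hv' k₁ k₂
  simp only [Pi.add_apply, linOp_eq]
  refine Eq.trans ?_ (integral_add k₁ k₂)
  refine integral_congr_ae ?_
  filter_upwards [hv'] with q hq
  simp only [Pi.add_apply] at hv hq
  simp only [gainDensity, lossDensity, hv, hq]
  ring

/-! ### Spreading of mass -/

/-- The transition probability density is bounded below by `κ exp(-7(|v|² + |x|²)/4)`. -/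
def TransitionBound (d : ℕ) (γ : ℝ) (b : ℝ → ℝ) (κ : ℝ) : Prop :=
  ∀ φ : Vel d → ℝ≥0∞, Measurable φ → ∀ v : Vel d,
    ENNReal.ofReal (κ * weight v) * ∫⁻ x, ENNReal.ofReal (weight x) * φ x ≤
      ∫⁻ p : Vel d × USphere d, ENNReal.ofReal (kernel γ b v p.1 p.2 * maxwellian d p.1) *
        φ (vPrime v p.1 p.2) ∂(volume.prod (surface d))

lemma norm_indicator_one_le (B : Set (Vel d)) (x : Vel d) :
    ‖B.indicator (1 : Vel d → ℝ) x‖ ≤ 1 := by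
  by_cases hx : x ∈ B <;> simp [hx]

lemma integrable_mul_transition (hd : d ≠ 0) {γ : ℝ} (hγ : -(d : ℝ) < γ)
    (hγ₀ : γ ≤ 0) {b : ℝ → ℝ} (hb : IsAngularKernel d b) {g : Vel d → ℝ} (hg : Integrable g)
    {B : Set (Vel d)} (hB : MeasurableSet B) :
    Integrable fun v => g v * (∫ q : Vel d × USphere d, B.indicator 1 (vPrime v q.1 q.2) *
        (kernel γ b v q.1 q.2 * maxwellian d q.1) ∂(volume.prod (surface d))) := by
  have h := ((integrable_lossDensity hd hγ hγ₀ hb hg).bdd_mul (c := 1)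
    (((measurable_one (α := ℝ)).indicator hB).comp measurable_vPrime).aestronglyMeasurable
    (Filter.Eventually.of_forall fun p => norm_indicator_one_le B _)).integral_prod_left
  refine h.congr (Filter.Eventually.of_forall fun v => ?_)
  simp only [lossDensity_eq, Function.comp]
  rw [← integral_const_mul]
  refine integral_congr_ae (Filter.Eventually.of_forall fun q => ?_)
  ring_nf

lemma TransitionBound.le_integral (hd : d ≠ 0) {γ : ℝ} (hγ : -(d : ℝ) < γ)
    (hγ₀ : γ ≤ 0) {b : ℝ → ℝ} (hb : IsAngularKernel d b) {κ : ℝ} (hκ : 0 < κ)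
    (h : TransitionBound d γ b κ) {B : Set (Vel d)} (hB : MeasurableSet B) (v : Vel d) :
    κ * weight v * ∫ x in B, weight x ≤
      ∫ q : Vel d × USphere d, B.indicator 1 (vPrime v q.1 q.2) *
        (kernel γ b v q.1 q.2 * maxwellian d q.1) ∂(volume.prod (surface d)) := by
  have hnn : ∀ q : Vel d × USphere d, 0 ≤ B.indicator (1 : Vel d → ℝ) (vPrime v q.1 q.2) *
        (kernel γ b v q.1 q.2 * maxwellian d q.1) := fun q =>
    mul_nonneg (indicator_nonneg (fun _ _ => zero_le_one) _)
      (mul_nonneg (kernel_nonneg hb γ _ _ _) (maxwellian_pos _).le)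
  have hi : Integrable (fun q : Vel d × USphere d => B.indicator (1 : Vel d → ℝ)
      (vPrime v q.1 q.2) * (kernel γ b v q.1 q.2 * maxwellian d q.1))
      (volume.prod (surface d)) :=
    (integrable_kernel hd hγ hγ₀ hb v).bdd_mul (c := 1)
      (((measurable_one (α := ℝ)).indicator hB).comp
        (measurable_vPrime_right v)).aestronglyMeasurable
      (Filter.Eventually.of_forall fun p => norm_indicator_one_le B _)
  rw [← ENNReal.ofReal_le_ofReal_iff (integral_nonneg hnn),
    ofReal_integral_eq_lintegral_ofReal hi (Filter.Eventually.of_forall hnn),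
    ENNReal.ofReal_mul (mul_nonneg hκ.le (weight_pos v).le),
    ofReal_integral_eq_lintegral_ofReal integrable_weight.integrableOn
      (Filter.Eventually.of_forall fun x => (weight_pos x).le), ← lintegral_indicator hB]
  convert h (B.indicator 1) (measurable_one.indicator hB) v using 2
  · refine lintegral_congr fun x => ?_
    by_cases hx : x ∈ B <;> simp [hx]
  · ext q
    by_cases hx : vPrime v q.1 q.2 ∈ B <;> simp [hx]

/-- Spreading of mass by the collision operator. -/
lemma TransitionBound.setIntegral_linOp_ge (hd : d ≠ 0) (e₀ : USphere d) {γ : ℝ}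
    (hγ : -(d : ℝ) < γ) (hγ₀ : γ ≤ 0) {b : ℝ → ℝ} (hb : IsAngularKernel d b) {κ : ℝ}
    (hκ : 0 < κ) (h : TransitionBound d γ b κ) {g : Vel d → ℝ} (hg : Integrable g)
    (hg₀ : ∀ᵐ v, 0 ≤ g v) {B : Set (Vel d)} (hB : MeasurableSet B) :
    κ * (∫ x in B, weight x) * (∫ v, weight v * g v) -
      collisionFreqNorm d γ b * (∫ v in B, g v) ≤ ∫ v in B, linOp γ b g v := by
  rw [setIntegral_linOp hd e₀ hγ hγ₀ hb hg hB]
  refine sub_le_sub ?_ ?_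
  · rw [← integral_const_mul]
    refine integral_mono_ae ((hg.bdd_mul (c := 1) measurable_weight.aestronglyMeasurable
      (Filter.Eventually.of_forall fun v => ?_)).const_mul _)
      (integrable_mul_transition hd hγ hγ₀ hb hg hB) ?_
    · rw [Real.norm_of_nonneg (weight_pos v).le]; exact weight_le_one v
    · filter_upwards [hg₀] with v hv
      have := mul_le_mul_of_nonneg_left (h.le_integral hd hγ hγ₀ hb hκ hB v) hv
      refine le_trans (le_of_eq ?_) this
      ring
  · rw [← integral_const_mul]
    refine integral_mono_of_nonneg ?_ (hg.integrableOn.const_mul _) ?_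
    · filter_upwards [ae_restrict_of_ae hg₀] with v hv
      exact mul_nonneg hv (collisionFreq_nonneg hb γ v)
    · filter_upwards [ae_restrict_of_ae hg₀] with v hv
      rw [mul_comm]
      exact mul_le_mul_of_nonneg_right (collisionFreq_le_norm hd hγ hγ₀ hb v) hv

/-! ### Continuous functionals on `L¹` and mild solutions -/

lemma LOne.integrable (g : LOne d) : Integrable g volume := L1.integrable_coeFn g

/-- Integration against a bounded function is a continuous linear functional on `L¹`. -/
lemma exists_clm_integral_mul {w : Vel d → ℝ} (hw : Measurable w) (hw₁ : ∀ x, ‖w x‖ ≤ 1) :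
    ∃ ℓ : LOne d →L[ℝ] ℝ, ∀ g : LOne d, ℓ g = ∫ v, w v * g v := by
  have hi : ∀ g : LOne d, Integrable (fun v => w v * g v) := fun g =>
    (LOne.integrable g).bdd_mul (c := 1) hw.aestronglyMeasurable (Filter.Eventually.of_forall hw₁)
  let L : LOne d →ₗ[ℝ] ℝ :=
    { toFun := fun g => ∫ v, w v * g v
      map_add' := fun g h => by
        rw [← integral_add (hi g) (hi h)]
        refine integral_congr_ae ?_
        filter_upwards [Lp.coeFn_add g h] with v hv
        rw [hv, Pi.add_apply, mul_add]
      map_smul' := fun c g => by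
        rw [RingHom.id_apply, smul_eq_mul, ← integral_const_mul]
        refine integral_congr_ae ?_
        filter_upwards [Lp.coeFn_smul c g] with v hv
        rw [hv, Pi.smul_apply, smul_eq_mul]
        ring }
  refine ⟨L.mkContinuous 1 fun g => ?_, fun g => rfl⟩
  rw [one_mul, L1.norm_eq_integral_norm]
  refine norm_integral_le_of_norm_le (LOne.integrable g).norm
    (Filter.Eventually.of_forall fun v => ?_)
  rw [norm_mul]
  exact mul_le_of_le_one_left (norm_nonneg _) (hw₁ v)

lemma setIntegral_eq_integral_indicator_mul (g : Vel d → ℝ) {B : Set (Vel d)}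
    (hB : MeasurableSet B) : ∫ v in B, g v = ∫ v, B.indicator 1 v * g v := by
  rw [← integral_indicator hB]
  refine integral_congr_ae (Filter.Eventually.of_forall fun v => ?_)
  by_cases hv : v ∈ B <;> simp [hv]

lemma exists_clm_setIntegral {B : Set (Vel d)} (hB : MeasurableSet B) :
    ∃ ℓ : LOne d →L[ℝ] ℝ, ∀ g : LOne d, ℓ g = ∫ v in B, g v := by
  obtain ⟨ℓ, hℓ⟩ := exists_clm_integral_mul (measurable_one.indicator hB)
    (norm_indicator_one_le B)
  exact ⟨ℓ, fun g => by rw [hℓ, setIntegral_eq_integral_indicator_mul _ hB]⟩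

lemma exists_clm_weight : ∃ ℓ : LOne d →L[ℝ] ℝ, ∀ g : LOne d, ℓ g = ∫ v, weight v * g v :=
  exists_clm_integral_mul measurable_weight fun x => by
    rw [Real.norm_of_nonneg (weight_pos x).le]; exact weight_le_one x

section MildSolution

variable {f : ℝ → LOne d}

lemma intervalIntegrable_of_continuousOn_Ici {E : Type*} [NormedAddCommGroup E] {u : ℝ → E}
    (hu : ContinuousOn u (Ici 0)) {s t : ℝ} (hs : 0 ≤ s) (ht : 0 ≤ t) :
    IntervalIntegrable u volume s t :=
  (hu.mono fun _ hx => (le_min hs ht).trans hx.1).intervalIntegrable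

/-- Point evaluation makes no sense on `L¹`, so the sign is tested on set integrals, which commute
with the Bochner integral in time. -/
lemma intervalIntegral_nonneg_ae (hf : ContinuousOn f (Ici 0))
    (hf₀ : ∀ t : ℝ, 0 ≤ t → ∀ᵐ v, 0 ≤ f t v) {s t : ℝ} (hs : 0 ≤ s) (hst : s ≤ t) :
    ∀ᵐ v, 0 ≤ (∫ τ in s..t, f τ : LOne d) v := by
  refine ae_nonneg_of_forall_setIntegral_nonneg (LOne.integrable _) fun B hB _ => ?_
  obtain ⟨ℓ, hℓ⟩ := exists_clm_setIntegral hB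
  rw [← hℓ, ← ℓ.intervalIntegral_comp_comm
    (intervalIntegrable_of_continuousOn_Ici hf hs (hs.trans hst))]
  refine intervalIntegral.integral_nonneg hst fun τ hτ => ?_
  rw [hℓ]
  exact setIntegral_nonneg_of_ae (hf₀ τ (hs.trans hτ.1))

variable {γ : ℝ} {b : ℝ → ℝ} {f₀ : LOne d}

/-- Conservation of mass along a mild solution. -/
lemma IsMildSolution.integral_eq (hsol : IsMildSolution γ b f₀ f) (hd : d ≠ 0) (e₀ : USphere d)
    (hγ : -(d : ℝ) < γ) (hγ₀ : γ ≤ 0) (hb : IsAngularKernel d b) {t : ℝ} (ht : 0 ≤ t) :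
    ∫ v, f t v = ∫ v, f₀ v := by
  rw [integral_congr_ae (hsol.equation t ht), integral_add (LOne.integrable _)
    (integrable_linOp hd e₀ hγ hγ₀ hb (LOne.integrable _)),
    integral_linOp hd e₀ hγ hγ₀ hb (LOne.integrable _), add_zero]

/-- The equation of a mild solution between two times. -/
lemma IsMildSolution.ae_eq_add (hsol : IsMildSolution γ b f₀ f) (hd : d ≠ 0) (e₀ : USphere d)
    (hγ : -(d : ℝ) < γ) (hγ₀ : γ ≤ 0) (hb : IsAngularKernel d b) {s t : ℝ} (hs : 0 ≤ s)
    (hst : s ≤ t) : ∀ᵐ v, f t v = f s v + linOp γ b (⇑(∫ τ in s..t, f τ)) v := by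
  have hadd : (∫ τ in (0 : ℝ)..t, f τ) = (∫ τ in (0 : ℝ)..s, f τ) + ∫ τ in s..t, f τ :=
    (intervalIntegral.integral_add_adjacent_intervals
      (intervalIntegrable_of_continuousOn_Ici hsol.continuousOn le_rfl hs)
      (intervalIntegrable_of_continuousOn_Ici hsol.continuousOn hs (hs.trans hst))).symm
  have h := Lp.coeFn_add (∫ τ in (0 : ℝ)..s, f τ) (∫ τ in s..t, f τ)
  rw [← hadd] at h
  filter_upwards [hsol.equation t (hs.trans hst), hsol.equation s hs,
    linOp_add_ae hd e₀ hγ hγ₀ hb (LOne.integrable _) (LOne.integrable _) h] with v h1 h2 h3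
  rw [h1, h2, h3, Pi.add_apply, add_assoc]

/-- The spreading estimate is applied once, to the time integral `∫ₛᵗ f`; continuous functionals
then carry the time integral outside. -/
lemma IsMildSolution.setIntegral_ge (hsol : IsMildSolution γ b f₀ f)
    (hf₀ : ∀ t : ℝ, 0 ≤ t → ∀ᵐ v, 0 ≤ f t v) (hd : d ≠ 0) (e₀ : USphere d)
    (hγ : -(d : ℝ) < γ) (hγ₀ : γ ≤ 0) (hb : IsAngularKernel d b) {κ : ℝ} (hκ : 0 < κ)
    (h : TransitionBound d γ b κ) {B : Set (Vel d)} (hB : MeasurableSet B) {s t : ℝ}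
    (hs : 0 ≤ s) (hst : s ≤ t) :
    (∫ v in B, f s v) + (κ * (∫ x in B, weight x) * (∫ τ in s..t, ∫ v, weight v * f τ v) -
      collisionFreqNorm d γ b * (∫ τ in s..t, ∫ v in B, f τ v)) ≤ ∫ v in B, f t v := by
  obtain ⟨ℓ, hℓ⟩ := exists_clm_setIntegral hB
  obtain ⟨m, hm⟩ := exists_clm_weight (d := d)
  have hi := intervalIntegrable_of_continuousOn_Ici hsol.continuousOn hs (hs.trans hst)
  have h1 := h.setIntegral_linOp_ge hd e₀ hγ hγ₀ hb hκ (LOne.integrable (∫ τ in s..t, f τ))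
    (intervalIntegral_nonneg_ae hsol.continuousOn hf₀ hs hst) hB
  rw [← hℓ, ← hm, ← ℓ.intervalIntegral_comp_comm hi, ← m.intervalIntegral_comp_comm hi] at h1
  simp only [hℓ, hm] at h1
  rw [integral_congr_ae (ae_restrict_of_ae (hsol.ae_eq_add hd e₀ hγ hγ₀ hb hs hst)),
    integral_add (LOne.integrable _).integrableOn
      (integrable_linOp hd e₀ hγ hγ₀ hb (LOne.integrable _)).integrableOn]
  gcongr

/-- A continuous function with `w(t) - w(s) ≥ -S ∫ₛᵗ w` stays nonnegative. -/
lemma nonneg_of_increment {w : ℝ → ℝ} {S T : ℝ} (hS : 0 ≤ S) (hT : 0 ≤ T)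
    (hw : ContinuousOn w (Icc 0 T)) (h0 : 0 ≤ w 0)
    (h : ∀ s, 0 ≤ s → s ≤ T → w s - S * ∫ τ in s..T, w τ ≤ w T) : 0 ≤ w T := by
  by_contra! hneg
  have hK : IsCompact (Icc 0 T ∩ w ⁻¹' Ici 0) :=
    isCompact_Icc.of_isClosed_subset (hw.preimage_isClosed_of_isClosed isClosed_Icc isClosed_Ici)
      inter_subset_left
  -- `s` is the last time at which `w` is nonnegative. Beyond it the integral is nonpositive, so the
  -- increment inequality forces `w(T) ≥ w(s) ≥ 0`.
  obtain ⟨s, ⟨hs, hws⟩, hmax⟩ := hK.exists_isGreatest ⟨0, ⟨le_rfl, hT⟩, h0⟩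
  have hint : ∫ τ in s..T, w τ ≤ 0 := by
    have : 0 ≤ ∫ τ in s..T, -w τ := by
      rw [intervalIntegral.integral_of_le hs.2]
      refine setIntegral_nonneg measurableSet_Ioc fun τ hτ => ?_
      by_contra! hτ'
      exact absurd (hmax ⟨⟨hs.1.trans hτ.1.le, hτ.2⟩, (neg_lt_zero.1 hτ').le⟩) (not_le.2 hτ.1)
    rw [intervalIntegral.integral_neg] at this
    linarith
  have h1 := h s hs.1 hs.2
  have h2 : 0 ≤ w s := hws
  nlinarith

/-- Duhamel's inequality in integrated form. -/
lemma ge_of_increment {y : ℝ → ℝ} {S c T : ℝ} (hS : 0 ≤ S) (hT : 0 ≤ T)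
    (hy : ContinuousOn y (Icc 0 T)) (h0 : 0 ≤ y 0)
    (h : ∀ s, 0 ≤ s → s ≤ T → y s + (c * S * (T - s) - S * ∫ τ in s..T, y τ) ≤ y T) :
    c * (1 - Real.exp (-(S * T))) ≤ y T := by
  -- The comparison function solves `q' = S (c - q)`, `q(0) = 0`, so `y - q` satisfies the
  -- homogeneous increment inequality.
  have hq : ∀ τ, HasDerivAt (fun τ => c * (1 - Real.exp (-(S * τ))))
      (S * (c * Real.exp (-(S * τ)))) τ := by
    intro τ
    have h1 : HasDerivAt (fun τ => -(S * τ)) (-(S * 1)) τ := ((hasDerivAt_id τ).const_mul S).neg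
    exact ((h1.exp.const_sub 1).const_mul c).congr_deriv (by ring)
  have key := nonneg_of_increment (w := fun τ => y τ - c * (1 - Real.exp (-(S * τ)))) hS hT
    (hy.sub (by fun_prop)) (by simpa using h0) fun s hs hsT => ?_
  · linarith
  · have e1 : ∫ τ in s..T, (y τ - c * (1 - Real.exp (-(S * τ)))) =
        (∫ τ in s..T, y τ) - ∫ τ in s..T, c * (1 - Real.exp (-(S * τ))) := by
      refine intervalIntegral.integral_sub ?_ (Continuous.intervalIntegrable (by fun_prop) _ _)
      refine (hy.mono ?_).intervalIntegrable
      rw [uIcc_of_le hsT]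
      exact Icc_subset_Icc_left hs
    have e2 : ∫ τ in s..T, c * (1 - Real.exp (-(S * τ))) =
        c * (T - s) - ∫ τ in s..T, c * Real.exp (-(S * τ)) := by
      simp only [mul_sub, mul_one]
      rw [intervalIntegral.integral_sub (by simp)
        (Continuous.intervalIntegrable (by fun_prop) _ _)]
      simp
      ring
    have e3 : S * ∫ τ in s..T, c * Real.exp (-(S * τ)) =
        c * (1 - Real.exp (-(S * T))) - c * (1 - Real.exp (-(S * s))) := by
      rw [← intervalIntegral.integral_const_mul]
      exact intervalIntegral.integral_eq_sub_of_hasDerivAt (fun τ _ => hq τ)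
        (Continuous.intervalIntegrable (by fun_prop) _ _)
    have h1 := h s hs hsT
    rw [e1, e2]
    linarith

/-- Instantaneous appearance of a Maxwellian lower bound. -/
lemma IsMildSolution.ae_ge (hsol : IsMildSolution γ b f₀ f)
    (hf₀ : ∀ t : ℝ, 0 ≤ t → ∀ᵐ v, 0 ≤ f t v) (hd : d ≠ 0) (e₀ : USphere d)
    (hγ : -(d : ℝ) < γ) (hγ₀ : γ ≤ 0) (hb : IsAngularKernel d b) {κ : ℝ} (hκ : 0 < κ)
    (h : TransitionBound d γ b κ) (hS : 0 < collisionFreqNorm d γ b) {t α : ℝ} (ht : 0 ≤ t)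
    (hα : ∀ τ ∈ Icc 0 t, α ≤ ∫ v, weight v * f τ v) :
    ∀ᵐ v, κ * α / collisionFreqNorm d γ b *
      (1 - Real.exp (-(collisionFreqNorm d γ b * t))) * weight v ≤ f t v := by
  set S := collisionFreqNorm d γ b
  refine ae_le_of_forall_setIntegral_le (integrable_weight.const_mul _) (LOne.integrable _)
    fun B hB _ => ?_
  rw [integral_const_mul]
  obtain ⟨ℓ, hℓ⟩ := exists_clm_setIntegral hB
  obtain ⟨m, hm⟩ := exists_clm_weight (d := d)
  have hwB : 0 ≤ ∫ x in B, weight x := integral_nonneg fun x => (weight_pos x).le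
  have hcont : ContinuousOn (fun τ => ∫ v in B, f τ v) (Icc 0 t) := by
    have := ℓ.continuous.comp_continuousOn (hsol.continuousOn.mono fun x (hx : x ∈ Icc 0 t) => hx.1)
    exact this.congr fun τ _ => (hℓ _).symm
  -- `c` is the equilibrium value: `c S` equals the source `κ α ∫_B weight`.
  have key := ge_of_increment (y := fun τ => ∫ v in B, f τ v)
    (c := κ * α / S * ∫ x in B, weight x) hS.le ht hcont
    (setIntegral_nonneg_of_ae (hf₀ 0 le_rfl)) fun s hs hst => ?_
  · refine le_trans (le_of_eq ?_) key
    ring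
  · refine le_trans ?_ (hsol.setIntegral_ge hf₀ hd e₀ hγ hγ₀ hb hκ h hB hs hst)
    have hA : α * (t - s) ≤ ∫ τ in s..t, ∫ v, weight v * f τ v := by
      have hmi : IntervalIntegrable (fun τ => ∫ v, weight v * f τ v) volume s t := by
        refine intervalIntegrable_of_continuousOn_Ici ?_ hs ht
        exact (m.continuous.comp_continuousOn hsol.continuousOn).congr fun τ _ => (hm _).symm
      have := intervalIntegral.integral_mono_on hst (by simp) hmi
        (f := fun _ => α) fun τ hτ => hα τ ⟨hs.trans hτ.1, hτ.2⟩
      rw [intervalIntegral.integral_const, smul_eq_mul] at this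
      linarith
    have e : κ * α / S * (∫ x in B, weight x) * S * (t - s) =
        κ * (∫ x in B, weight x) * (α * (t - s)) := by
      field_simp
    rw [e]
    gcongr

end MildSolution

/-! ### Moments, constants and conclusion -/

/-- A probability density with a finite moment charges the Gaussian weight. -/
lemma integral_weight_mul_ge (hd : d ≠ 0) {g : Vel d → ℝ} (hg : Integrable g)
    (hg₀ : ∀ᵐ v, 0 ≤ g v) (hg₁ : ∫ v, g v = 1) {s : ℝ} (hs : 0 < s) (hM : moment s g ≠ ∞) :
    1 / 2 * Real.exp (-(7 / 4 * ((2 * moment s g) ^ (2 / s)).toReal)) ≤ ∫ v, weight v * g v := by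
  have : Nonempty (Fin d) := ⟨⟨0, Nat.pos_of_ne_zero hd⟩⟩
  have hnn : 0 ≤ᵐ[volume] fun v => ‖v‖ ^ s * g v := by
    filter_upwards [hg₀] with v hv
    exact mul_nonneg (by positivity) hv
  have hmeas : AEStronglyMeasurable (fun v : Vel d => ‖v‖ ^ s * g v) volume :=
    (Measurable.aestronglyMeasurable (by fun_prop)).mul hg.1
  have hi : Integrable (fun v => ‖v‖ ^ s * g v) := by
    refine ⟨hmeas, ?_⟩
    rw [hasFiniteIntegral_iff_ofReal hnn]
    exact hM.lt_top
  have hmom : ∫ v, ‖v‖ ^ s * g v = (moment s g).toReal :=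
    integral_eq_lintegral_of_nonneg_ae hnn hmeas
  set M := (moment s g).toReal with hMdef
  -- A vanishing moment would force `g = 0` almost everywhere, against unit mass.
  have hM0 : 0 < M := by
    refine lt_of_le_of_ne ENNReal.toReal_nonneg fun h0 => ?_
    rw [← h0, integral_eq_zero_iff_of_nonneg_ae hnn hi] at hmom
    have : g =ᵐ[volume] 0 := by
      filter_upwards [hmom, (volume : Measure (Vel d)).ae_ne 0] with v hv hv0
      have hvs : ‖v‖ ^ s ≠ 0 := (Real.rpow_pos_of_pos (norm_pos_iff.2 hv0) s).ne'
      exact (mul_eq_zero.1 hv).resolve_left hvs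
    rw [integral_congr_ae this] at hg₁
    simp at hg₁
  have hR : ((2 * moment s g) ^ (2 / s)).toReal = (2 * M) ^ (2 / s) := by
    rw [← ENNReal.toReal_rpow, ENNReal.toReal_mul]; rfl
  rw [hR]
  set E := Real.exp (-(7 / 4 * (2 * M) ^ (2 / s))) with hE
  -- Chebyshev's inequality in pointwise form: integrated against `g`, the left side gives `E (1 - M
  -- / (2M)) = E / 2`.
  have hpt : ∀ v : Vel d, E * (1 - ‖v‖ ^ s / (2 * M)) ≤ weight v := by
    intro v
    by_cases hv : ‖v‖ ^ s ≤ 2 * M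
    · have h1 : ‖v‖ ^ 2 ≤ (2 * M) ^ (2 / s) := by
        have := Real.rpow_le_rpow (by positivity) hv (z := 2 / s) (by positivity)
        rw [← Real.rpow_mul (norm_nonneg v), mul_div_cancel₀ _ hs.ne'] at this
        exact_mod_cast this
      have h2 : E ≤ weight v := by
        rw [hE, weight, Real.exp_le_exp]; linarith
      refine le_trans (mul_le_of_le_one_right (Real.exp_pos _).le ?_) h2
      have : 0 ≤ ‖v‖ ^ s / (2 * M) := by positivity
      linarith
    · have h1 : 1 ≤ ‖v‖ ^ s / (2 * M) := by
        rw [le_div_iff₀ (by positivity)]; linarith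
      exact (mul_nonpos_of_nonneg_of_nonpos (Real.exp_pos _).le (by linarith)).trans
        (weight_pos v).le
  have hwi : Integrable fun v => weight v * g v :=
    hg.bdd_mul (c := 1) measurable_weight.aestronglyMeasurable
      (Filter.Eventually.of_forall fun v => by
        rw [Real.norm_of_nonneg (weight_pos v).le]; exact weight_le_one v)
  have hle : ∫ v, E * (g v - (2 * M)⁻¹ * (‖v‖ ^ s * g v)) ≤ ∫ v, weight v * g v := by
    refine integral_mono_ae ((hg.sub (hi.const_mul _)).const_mul _) hwi ?_
    filter_upwards [hg₀] with v hv
    refine le_trans (le_of_eq ?_) (mul_le_mul_of_nonneg_right (hpt v) hv)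
    ring
  rw [integral_const_mul, integral_sub hg (hi.const_mul _), integral_const_mul, hg₁, hmom] at hle
  refine le_trans (le_of_eq ?_) hle
  field_simp
  ring

/-- The fraction in `λ₁` is at least `1` as soon as its denominator is positive; when `d = 2` this
requires `γ < 0`. -/
lemma lambdaOne_ge {γ ν : ℝ} (hd : 2 ≤ d) (hγ₀ : γ ≤ 0) (hγd : d = 2 → γ < 0) (hν₀ : 0 ≤ ν) :
    7 / 4 ≤ lambdaOne d γ ν := by
  have hpos : 0 < (d : ℝ) - γ - 2 := by
    rcases hd.eq_or_lt with h | h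
    · have := hγd h.symm
      rw [← h]; push_cast; linarith
    · have : (3 : ℝ) ≤ d := by exact_mod_cast h
      linarith
  have : 1 ≤ (2 * ν + (d : ℝ) - γ - 2) / ((d : ℝ) - γ - 2) := by
    rw [one_le_div hpos]; linarith
  unfold lambdaOne
  linarith

lemma expNeg_le {lam : ℝ} (hl : 7 / 4 ≤ lam) (v : Vel d) {X Y : ℝ≥0∞} (hX : X ≠ ∞) (hY : Y ≤ X) :
    expNeg (ENNReal.ofReal lam * (ENNReal.ofReal (‖v‖ ^ 2) + X)) ≤
      weight v * Real.exp (-(7 / 4 * Y.toReal)) := by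
  have hne : ENNReal.ofReal lam * (ENNReal.ofReal (‖v‖ ^ 2) + X) ≠ ∞ :=
    ENNReal.mul_ne_top ENNReal.ofReal_ne_top (ENNReal.add_ne_top.2 ⟨ENNReal.ofReal_ne_top, hX⟩)
  rw [expNeg, if_neg hne, ENNReal.toReal_mul, ENNReal.toReal_add ENNReal.ofReal_ne_top hX,
    ENNReal.toReal_ofReal (by linarith), ENNReal.toReal_ofReal (by positivity), weight,
    ← Real.exp_add, Real.exp_le_exp]
  have h1 := ENNReal.toReal_mono hX hY
  have h2 : 0 ≤ X.toReal := ENNReal.toReal_nonneg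
  nlinarith [sq_nonneg ‖v‖]

/-- `Λ + 1` replaces the `b`-dependent `S` in the denominator and is positive even without knowing
`Λ > 0`; the `2` pays for the half lost in Chebyshev's inequality. -/
lemma mul_le_of_rate_bounds {κ S Λ t₀ t α w E : ℝ} (hκ : 0 < κ) (hS : 0 < S) (hSΛ : S ≤ Λ)
    (ht₀ : 0 ≤ t₀) (htt : t₀ ≤ t) (hα : 0 ≤ α) (hw : 0 ≤ w) (hE : E ≤ w * (2 * α)) :
    κ / (2 * (Λ + 1)) * (1 - Real.exp (-(S * t₀))) * E ≤
      κ * α / S * (1 - Real.exp (-(S * t))) * w := by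
  have hΛ : 0 < Λ := hS.trans_le hSΛ
  have h1 : 0 ≤ 1 - Real.exp (-(S * t₀)) := by
    rw [sub_nonneg, Real.exp_le_one_iff]; nlinarith
  have h2 : 1 - Real.exp (-(S * t₀)) ≤ 1 - Real.exp (-(S * t)) := by gcongr
  calc _ ≤ κ / (2 * (Λ + 1)) * (1 - Real.exp (-(S * t₀))) * (w * (2 * α)) := by gcongr
    _ = κ * α / (Λ + 1) * (1 - Real.exp (-(S * t₀))) * w := by field_simp
    _ ≤ κ * α / S * (1 - Real.exp (-(S * t))) * w := by
        gcongr
        linarith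

end LinearBoltzmann

end

open LinearBoltzmann in
theorem theorem4p4 (d : ℕ) (hd : 2 ≤ d) (γ b₀ ν : ℝ)
    (hγ : -(d : ℝ) < γ) (hγ₀ : γ ≤ 0) (hγd : d = 2 → γ < 0)
    (hb₀ : 0 < b₀) (hν₀ : 0 ≤ ν) (hν₁ : ν ≤ 1) :
    ∃ C : ℝ, 0 < C ∧
      ∀ b : ℝ → ℝ, LinearBoltzmann.IsAngularKernel d b →
        (∀ x ∈ Ioo (-1 : ℝ) 1, b₀ * (1 - |x| ^ 2) ^ (ν / 2) ≤ b x) →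
      ∀ f₀ : LinearBoltzmann.LOne d, (∀ᵐ v, 0 ≤ f₀ v) → ∫ v, f₀ v = 1 →
        Integrable (fun v => ‖v‖ ^ 2 * f₀ v) →
      ∀ f : ℝ → LinearBoltzmann.LOne d, LinearBoltzmann.IsMildSolution γ b f₀ f →
        (∀ t : ℝ, 0 ≤ t → ∀ᵐ v, 0 ≤ f t v) →
      ∀ t : ℝ, 0 < t → ∀ᵐ v, ∀ s : ℝ, 0 < s → ∀ t₀ : ℝ, 0 < t₀ → t₀ < t →
        C * (1 - Real.exp (-(LinearBoltzmann.collisionFreqNorm d γ b * t₀))) *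
          LinearBoltzmann.expNeg (ENNReal.ofReal (LinearBoltzmann.lambdaOne d γ ν) *
            (ENNReal.ofReal (‖v‖ ^ 2) +
              ⨆ τ ∈ Icc (0 : ℝ) t, (2 * LinearBoltzmann.moment s (f τ)) ^ (2 / s)))
          ≤ f t v := by
  have hd0 : d ≠ 0 := by omega
  obtain ⟨m, hm, -⟩ := exists_unit_orthogonal hd (0 : Vel d)
  have e₀ : USphere d := ⟨m, by simpa using hm⟩
  obtain ⟨κ, hκ, hbound⟩ := exists_transition_ge hd hγ₀ hb₀ hν₁
  set Λ : ℝ := (freqBound d γ).toReal with hΛ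
  have hΛ0 : 0 ≤ Λ := ENNReal.toReal_nonneg
  refine ⟨κ / (2 * (Λ + 1)), by positivity, ?_⟩
  intro b hb hlow f₀ _ hf₀1 _ f hsol hfnn t ht
  have hlam := lambdaOne_ge hd hγ₀ hγd hν₀
  have hSΛ : collisionFreqNorm d γ b ≤ Λ := collisionFreqNorm_le hd0 hγ hγ₀ hb
  -- If `‖Σ‖ = 0`, the factor `1 - e^0` vanishes and nonnegativity suffices; otherwise division by
  -- `‖Σ‖` is allowed.
  rcases (collisionFreqNorm_nonneg d γ b).eq_or_lt with hS | hS
  · filter_upwards [hfnn t ht.le] with v hv s _ t₀ _ _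
    simpa [← hS] using hv
  obtain ⟨ℓ, hℓ⟩ := exists_clm_weight (d := d)
  have hcont : ContinuousOn (fun τ => ∫ v, weight v * f τ v) (Icc 0 t) :=
    (ℓ.continuous.comp_continuousOn (hsol.continuousOn.mono fun x (hx : x ∈ Icc 0 t) => hx.1)).congr
      fun τ _ => (hℓ _).symm
  -- The minimising time depends neither on `s` nor on `t₀`, so one null set of velocities serves
  -- them all, and only the moments at `τ₀` are needed.
  obtain ⟨τ₀, hτ₀, hmin⟩ := isCompact_Icc.exists_isMinOn (nonempty_Icc.2 ht.le) hcont
  have hge := hsol.ae_ge hfnn hd0 e₀ hγ hγ₀ hb hκ (hbound b hb hlow) hS ht.le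
    (fun τ hτ => hmin hτ)
  filter_upwards [hge, hfnn t ht.le] with v hv hv0 s hs t₀ ht₀ htt
  set X : ℝ≥0∞ := ⨆ τ ∈ Icc (0 : ℝ) t, (2 * moment s (f τ)) ^ (2 / s) with hX
  by_cases hXt : X = ∞
  · have : ENNReal.ofReal (lambdaOne d γ ν) * (ENNReal.ofReal (‖v‖ ^ 2) + X) = ∞ := by
      rw [hXt, add_top, ENNReal.mul_top]
      simp only [ne_eq, ENNReal.ofReal_eq_zero, not_le]
      linarith
    rw [expNeg, if_pos this, mul_zero]
    exact hv0
  have hYX : (2 * moment s (f τ₀)) ^ (2 / s) ≤ X :=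
    le_iSup₂_of_le (f := fun τ (_ : τ ∈ Icc (0 : ℝ) t) => (2 * moment s (f τ)) ^ (2 / s))
      τ₀ hτ₀ le_rfl
  -- An infinite moment at `τ₀` would make the supremum infinite, since `2 / s > 0`.
  have hmom : moment s (f τ₀) ≠ ∞ := by
    intro hM
    rw [hM, ENNReal.mul_top two_ne_zero, ENNReal.top_rpow_of_pos (by positivity)] at hYX
    exact hXt (top_le_iff.1 hYX)
  have hα := integral_weight_mul_ge hd0 (LOne.integrable _) (hfnn τ₀ hτ₀.1)
    ((hsol.integral_eq hd0 e₀ hγ hγ₀ hb hτ₀.1).trans hf₀1) hs hmom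
  have hexp := expNeg_le hlam v hXt hYX
  set S := collisionFreqNorm d γ b
  set α := ∫ v, weight v * f τ₀ v
  refine le_trans ?_ hv
  exact mul_le_of_rate_bounds hκ hS hSΛ ht₀.le htt.le (le_trans (by positivity) hα)
    (weight_pos v).le (hexp.trans (mul_le_mul_of_nonneg_left (by linarith) (weight_pos v).le))
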